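/- For a field $K$ of characteristic different from $2$, let $\mathcal S_K$ be the set of polynomials $D\in K[T]$ of positive even degree that are not squares in $K[T]$ and whose leading coefficient is a square in $K$. Each $D\in\mathcal S_K$ has a square root $\sqrt D$ in the field $K((T^{-1}))$ of formal Laurent series, unique up to sign; the statements below hold for either choice of the sign. Every $\alpha\in K((T^{-1}))$ has a unique regular continued fraction expansion $\alpha=[a_0,a_1,a_2,\dots]$ with $a_n\in K[T]$ and $\deg a_n\ge 1$ for $n\ge 1$. Put $K(\alpha)=\sup_{n\ge1}\deg a_n$ and, for irrational $\alpha$, $\overline K(\alpha)=\limsup_n\deg a_n$. The convergents $p_n/q_n=[a_0,\dots,a_n]$ have denominators given by $q_0=1$, $q_1=a_1$, $q_{n+2}=a_{n+2}q_{n+1}+q_n$. A quadratic irrationality in $K(T,\sqrt D)$ is a series $(A+B\sqrt D)/C$ with $A,B,C\in K[T]$ and $B,C\neq0$. Two series are equivalent if one is the image of the other under a Möbius transformation with matrix in $\mathrm{GL}_2(K[T])$. **Theorem.** (1) Let $D\in\mathcal S_{\overline{\mathbb Q}}$ have degree $2d$, and let $\mathbb K_D\subset\overline{\mathbb Q}$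 be the number field generated by the coefficients of $D$ and a square root of its leading coefficient. There is an $N$ depending only on $D$ such that the following holds for every nonzero prime ideal $\mathfrak p$ of the ring of integers of $\mathbb K_D$ with norm at least $N$, every uniformizer $\pi\in\mathbb K_D$ at $\mathfrak p$ (that is, $v_{\mathfrak p}(\pi)=1$) and every integer $r\ge d$: for every $\lambda=\zeta_r\sqrt[r]{1/\pi}\in\overline{\mathbb Q}$, where $\zeta_r$ is an $r$-th root of unity and $\sqrt[r]{1/\pi}$ is any $r$-th root of $1/\pi$, we have $q_n(\lambda)\neq0$ for every $n\ge0$, where $p_n/q_n$ are the convergents of $\sqrt D$. (2) For every $D\in\mathcal S_{\overline{\mathbb Q}}$ of degree $2d$ there exists a $(d-1)$-tuple $(\lambda_1,\dots,\lambda_{d-1})\in\overline{\mathbb Q}^{\,d-1}$ such that $$K\big((T-\lambda_1)\cdots(T-\lambda_{d-1})\sqrt D\big)=1,$$ and if $d\ge2$ there are infinitely many such tuples. (For $d=1$ the only tuple is the empty one, and the assertion is $K(\sqrt D)=1$.) (3) For every $D\in\mathcal S_{\overline{\mathbb Q}}$ there are infinitely many monic polynomials $P\in\overline{\mathbb Q}[T]$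 such that $\overline K(P\sqrt D)=1$. (4) (McMullen's strong conjecture over $\overline{\mathbb Q}$.) For every $D\in\mathcal S_{\overline{\mathbb Q}}$ there are infinitely many pairwise non-equivalent quadratic irrationalities $\alpha\in\overline{\mathbb Q}(T,\sqrt D)$ with $K(\alpha)\le1$. -/

import Mathlib

open Polynomial

namespace PolyCF

noncomputable section

/-! ### Formal Laurent series in `T⁻¹`

`LaurentSeries K` has the variable `X`; we read `X` as `T⁻¹`, so that `LaurentSeries K` is the field
`K((T⁻¹))` and the coefficient of `T ^ i` in `α` is `α.coeff (-i)`. -/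

/-- The inclusion `K[T] → K((T⁻¹))`; the variable `T` is sent to `X⁻¹`. -/
def ofPoly {K : Type*} [Field K] : K[X] →+* LaurentSeries K :=
  Polynomial.eval₂RingHom HahnSeries.C (HahnSeries.single (-1 : ℤ) (1 : K))

/-- The polynomial part `⌊α⌋` of `α`: the sum of the terms `c_i T ^ i` of `α` with `i ≥ 0`. -/
def polyPart {K : Type*} [Field K] (α : LaurentSeries K) : K[X] :=
  ∑ i ∈ Finset.range ((-α.order).toNat + 1), Polynomial.monomial i (α.coeff (-(i : ℤ)))

/-! ### Regular continued fractions -/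

/-- The complete quotients `α_0 = α`, `α_{n+1} = 1 / (α_n - ⌊α_n⌋)` of `α`. If some `α_m` is a
polynomial (this happens for rational `α` only) the expansion stops at `m`; the later values are then
equal to `0`. -/
def completeQuotient {K : Type*} [Field K] (α : LaurentSeries K) : ℕ → LaurentSeries K
  | 0 => α
  | n + 1 => (completeQuotient α n - ofPoly (polyPart (completeQuotient α n)))⁻¹

/-- The partial quotients `a_n = ⌊α_n⌋`, so that `α = [a_0, a_1, …]`. (They are `0` after the end of a
finite expansion.) -/
def partialQuotient {K : Type*} [Field K] (α : LaurentSeries K) (n : ℕ) : K[X] :=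
  polyPart (completeQuotient α n)

/-- The numerators `p_n` of the convergents `p_n / q_n = [a_0, …, a_n]`:
`p_0 = a_0`, `p_1 = a_1 a_0 + 1`, `p_{n+2} = a_{n+2} p_{n+1} + p_n`. -/
def convNum {K : Type*} [Field K] (α : LaurentSeries K) : ℕ → K[X]
  | 0 => partialQuotient α 0
  | 1 => partialQuotient α 1 * partialQuotient α 0 + 1
  | n + 2 => partialQuotient α (n + 2) * convNum α (n + 1) + convNum α n

/-- The denominators `q_n` of the convergents `p_n / q_n = [a_0, …, a_n]`:
`q_0 = 1`, `q_1 = a_1`, `q_{n+2} = a_{n+2} q_{n+1} + q_n`. -/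
def convDen {K : Type*} [Field K] (α : LaurentSeries K) : ℕ → K[X]
  | 0 => 1
  | 1 => partialQuotient α 1
  | n + 2 => partialQuotient α (n + 2) * convDen α (n + 1) + convDen α n

/-- `K(α) = sup_{n ≥ 1} deg a_n ∈ ℕ ∪ {∞}`. -/
def supDeg {K : Type*} [Field K] (α : LaurentSeries K) : ℕ∞ :=
  ⨆ n : ℕ, ((partialQuotient α (n + 1)).natDegree : ℕ∞)

/-- `limsup_n deg a_n ∈ ℕ ∪ {∞}`, for an irrational `α`. -/
def limsupDeg {K : Type*} [Field K] (α : LaurentSeries K) : ℕ∞ :=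
  Filter.limsup (fun n : ℕ => ((partialQuotient α n).natDegree : ℕ∞)) Filter.atTop

/-! ### Square roots of polynomials and quadratic irrationalities -/

/-- `D` belongs to `S_K` (for a field `K` of characteristic different from `2`): `D` has positive even
degree, is not a square in `K[T]`, and its leading coefficient is a square in `K`. -/
structure MemS {K : Type*} [Field K] (D : K[X]) : Prop where
  natDegree_pos : 0 < D.natDegree
  even_natDegree : Even D.natDegree
  not_isSquare : ¬ IsSquare D
  isSquare_leadingCoeff : IsSquare D.leadingCoeff

/-- `s` is a square root of `D` in `K((T⁻¹))`, that is, one of the two choices of `√D`. -/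
def IsSqrt {K : Type*} [Field K] (s : LaurentSeries K) (D : K[X]) : Prop :=
  s ^ 2 = ofPoly D

/-- For `s = √D`: `α = (A + B √D) / C` with polynomials `A`, `B ≠ 0`, `C ≠ 0`, that is, `α` is a
quadratic irrationality in `K(T, √D)`. -/
def IsQuadIrr {K : Type*} [Field K] (s α : LaurentSeries K) : Prop :=
  ∃ A B C : K[X], B ≠ 0 ∧ C ≠ 0 ∧ α = (ofPoly A + ofPoly B * s) / ofPoly C

/-- `α ∼ β`: there is a matrix in `GL₂(K[T])` whose Möbius transformation sends `β` to `α`. -/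
def Equivalent {K : Type*} [Field K] (α β : LaurentSeries K) : Prop :=
  ∃ M : Matrix.GeneralLinearGroup (Fin 2) K[X],
    ofPoly (M 1 0) * β + ofPoly (M 1 1) ≠ 0 ∧
      α = (ofPoly (M 0 0) * β + ofPoly (M 0 1)) / (ofPoly (M 1 0) * β + ofPoly (M 1 1))

/-- The assertion of the multiplication conjecture for the field `K`: for every `D ∈ S_K` there are
infinitely many monic polynomials `P` such that `limsup_n deg a_n = 1` for `P √D = [a_0, a_1, …]`. -/
def MultConjecture (K : Type*) [Field K] : Prop :=
  ∀ D : K[X], MemS D → ∀ s : LaurentSeries K, IsSqrt s D →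
    {P : K[X] | P.Monic ∧ limsupDeg (ofPoly P * s) = 1}.Infinite

/-- McMullen's conjecture over `K` with the constant `m`: for every `D ∈ S_K` there are infinitely many
pairwise non-equivalent quadratic irrationalities `α` in `K(T, √D)` with `K(α) ≤ m`. -/
def McMullenConjecture (K : Type*) [Field K] (m : ℕ) : Prop :=
  ∀ D : K[X], MemS D → ∀ s : LaurentSeries K, IsSqrt s D →
    ∃ S : Set (LaurentSeries K), S.Infinite ∧
      (∀ α ∈ S, IsQuadIrr s α ∧ supDeg α ≤ (m : ℕ∞)) ∧
      S.Pairwise fun α β => ¬ Equivalent α β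

/-- McMullen's strong conjecture over `K`: the constant `1` is admissible. -/
def StrongMcMullenConjecture (K : Type*) [Field K] : Prop :=
  McMullenConjecture K 1

/-! ### Existence of the square root -/

theorem exists_powerSeries_sqrt {K : Type*} [Field K] [CharZero K] (f : PowerSeries K)
    (hf : PowerSeries.constantCoeff f = 1) : ∃ g : PowerSeries K, g ^ 2 = f := by
  have hs : PowerSeries.HasSubst (f - 1) :=
    PowerSeries.HasSubst.of_constantCoeff_zero' (by simp [hf])
  refine ⟨(PowerSeries.binomialSeries K (1 / 2 : ℚ)).subst (f - 1), ?_⟩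
  have h : PowerSeries.binomialSeries K (1 / 2 : ℚ) ^ 2 = 1 + PowerSeries.X := by
    rw [sq, ← PowerSeries.binomialSeries_add]
    have := PowerSeries.binomialSeries_nat (R := ℚ) (A := K) 1
    norm_num at this ⊢
    exact this
  rw [← PowerSeries.subst_pow hs, h, PowerSeries.subst_add hs, PowerSeries.subst_X hs,
    ← PowerSeries.coe_substAlgHom hs, map_one]
  ring

theorem eval₂_eq_reverse {R S : Type*} [CommRing R] [CommRing S] (i : R →+* S) {x y : S}
    (hyx : y * x = 1) (hxy : x * y = 1) (f : R[X]) :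
    Polynomial.eval₂ i x f = Polynomial.eval₂ i y f.reverse * x ^ f.natDegree := by
  let _ : Invertible x := ⟨y, hyx, hxy⟩
  exact (Polynomial.eval₂_reverse_mul_pow i x f).symm

theorem exists_isSqrt {K : Type*} [Field K] [CharZero K] {D : K[X]} (hD : MemS D) :
    ∃ s : LaurentSeries K, IsSqrt s D := by
  obtain ⟨c, hc⟩ := hD.isSquare_leadingCoeff
  obtain ⟨d, hd⟩ := hD.even_natDegree
  have hD0 : D ≠ 0 := by
    rintro rfl
    exact hD.not_isSquare ⟨0, by simp⟩
  have hl : D.leadingCoeff ≠ 0 := Polynomial.leadingCoeff_ne_zero.mpr hD0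
  obtain ⟨g, hg⟩ := exists_powerSeries_sqrt
    (PowerSeries.C (D.leadingCoeff⁻¹) * (D.reverse : PowerSeries K))
    (by simp [Polynomial.coeff_zero_reverse, hl])
  let x : LaurentSeries K := HahnSeries.single (-1 : ℤ) (1 : K)
  let y : LaurentSeries K := HahnSeries.single (1 : ℤ) (1 : K)
  have hyx : y * x = 1 := by simp [x, y]
  have hxy : x * y = 1 := by simp [x, y]
  have hrev : HahnSeries.ofPowerSeries ℤ K (D.reverse : PowerSeries K)
      = Polynomial.eval₂ HahnSeries.C y D.reverse := by
    have : (HahnSeries.ofPowerSeries ℤ K).comp (Polynomial.coeToPowerSeries.ringHom)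
        = Polynomial.eval₂RingHom HahnSeries.C y := by
      ext <;> simp [y]
    exact congrArg (fun φ : K[X] →+* LaurentSeries K => φ D.reverse) this
  have hofD : ofPoly D = Polynomial.eval₂ HahnSeries.C y D.reverse * x ^ D.natDegree :=
    eval₂_eq_reverse (HahnSeries.C : K →+* LaurentSeries K) hyx hxy D
  refine ⟨HahnSeries.C c * x ^ d * HahnSeries.ofPowerSeries ℤ K g, ?_⟩
  have hC : (HahnSeries.C c : LaurentSeries K) ^ 2 * HahnSeries.C (D.leadingCoeff⁻¹) = 1 := by
    rw [sq, ← map_mul, ← map_mul, ← hc, mul_inv_cancel₀ hl, map_one]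
  rw [IsSqrt, hofD, ← hrev, mul_pow, mul_pow, ← map_pow (HahnSeries.ofPowerSeries ℤ K), hg, map_mul, HahnSeries.ofPowerSeries_C, hd,
    ← pow_mul, show d * 2 = d + d by ring]
  linear_combination (x ^ (d + d) *
    HahnSeries.ofPowerSeries ℤ K (D.reverse : PowerSeries K)) * hC

/-! ### The field of definition of `√D` -/

/-- The field `K_D`: the extension of `ℚ` generated by the coefficients of `D` and by the square roots
of its leading coefficient. -/
def fieldOfSqrt (D : (AlgebraicClosure ℚ)[X]) : IntermediateField ℚ (AlgebraicClosure ℚ) :=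
  IntermediateField.adjoin ℚ (Set.range D.coeff ∪ {c | c ^ 2 = D.leadingCoeff})

instance numberField_fieldOfSqrt (D : (AlgebraicClosure ℚ)[X]) : NumberField (fieldOfSqrt D) := by
  have h1 : (Set.range D.coeff).Finite := by
    refine ((D.support.finite_toSet.image D.coeff).union (Set.finite_singleton 0)).subset ?_
    rintro _ ⟨n, rfl⟩
    by_cases h : D.coeff n = 0
    · right; simpa using h
    · left; exact ⟨n, by simpa using h, rfl⟩
  classical
  have h2 : {c : AlgebraicClosure ℚ | c ^ 2 = D.leadingCoeff}.Finite := by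
    refine ((X ^ 2 - C D.leadingCoeff).roots.toFinset.finite_toSet).subset ?_
    intro c hc
    have hne : (X ^ 2 - C D.leadingCoeff : (AlgebraicClosure ℚ)[X]) ≠ 0 :=
      X_pow_sub_C_ne_zero (by norm_num) _
    have hc' : c ^ 2 = D.leadingCoeff := hc
    simp [hne, hc']
  have : Finite ↥(Set.range D.coeff ∪ {c | c ^ 2 = D.leadingCoeff}) := (h1.union h2).to_subtype
  have hfd : FiniteDimensional ℚ (fieldOfSqrt D) :=
    IntermediateField.finiteDimensional_adjoin fun x _ =>
      ((AlgebraicClosure.isAlgebraic ℚ).isAlgebraic x).isIntegral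
  exact { to_charZero := inferInstance, to_finiteDimensional := hfd }

end

end PolyCF

namespace PolyCF

/-! ### Coefficients and orders of Laurent series in `T⁻¹` -/

section

variable {K : Type*} [Field K]

/-! The size of the partial quotients is governed by `ApproxBound α m`: no fraction with denominator
`q` has error `qα - p` of order above `deg q + m`. Applied to convergents it gives `deg a_n ≤ m` for
`n ≥ 1`. For `α = √D` with `deg D = 2d`, a Liouville argument gives it with `m = d`: a smaller error
would force the polynomial `Dq² - p²` to have positive order in `T⁻¹`, hence to vanish, and `D`
would be a square.

Multiplying by `T - a`, where `a` is a root of no `q_n`, lowers `m` by one as long as it exceeds `1`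
(`ApproxBound.X_sub_C_mul`). Indeed, by Legendre's theorem too good an approximation of `(T - a)α`
is a multiple of a convergent of `α`, and the factor `T - a` must sit in the multiplier; cancelling
it leaves a convergent that is itself too good. After `d - 1` steps all partial quotients are
linear. At each stage `P√D` is the square root of `P²D`, so it suffices to find infinitely many
admissible `a` for every polynomial of the class.

Such `a` come from reduction at a prime of good reduction. Scale `q_n` so that its largest
coefficient is a unit and reduce. The reduced fraction still approximates the reduced root to order
above `deg q_n`, and the Liouville bound over the residue field limits the drop in degree to `d - 1`
(`GoodReduction.exists_dominant_coeff`). So a coefficient of maximal absolute value occurs among the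
top `d`. If `λ^r = 1/π` with `r ≥ d`, powers of `λ` whose exponents differ modulo `r` cannot cancel,
and within one residue class the dominant coefficient wins, so `q_n(λ) ≠ 0`
(`aeval_ne_zero_of_dominant_coeff`).

Adding further factors keeps the exponent `1`, which gives monic multipliers of every large degree;
`Equivalent.associated` separates the resulting series. -/

theorem ofPoly_C (c : K) : ofPoly (C c) = HahnSeries.C c := by simp [ofPoly]

theorem ofPoly_X : ofPoly (X : K[X]) = HahnSeries.single (-1 : ℤ) (1 : K) := by simp [ofPoly]

theorem ofPoly_monomial (j : ℕ) (c : K) :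
    ofPoly (monomial j c) = HahnSeries.single (-(j : ℤ)) c := by
  rw [← C_mul_X_pow_eq_monomial, map_mul, map_pow, ofPoly_C, ofPoly_X, HahnSeries.single_pow]
  simp

/-- Coefficients of `q α` for a polynomial `q`. -/
theorem coeff_ofPoly_mul {q : K[X]} {n : ℕ} (hn : q.natDegree < n) (α : LaurentSeries K) (i : ℤ) :
    (ofPoly q * α).coeff i = ∑ j ∈ Finset.range n, q.coeff j * α.coeff (i + j) := by
  conv_lhs => rw [q.as_sum_range' n hn]
  rw [map_sum, Finset.sum_mul, HahnSeries.coeff_sum]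
  refine Finset.sum_congr rfl fun j _ => ?_
  rw [ofPoly_monomial, HahnSeries.coeff_single_mul, sub_neg_eq_add]

theorem coeff_ofPoly_neg (q : K[X]) (j : ℕ) : (ofPoly q).coeff (-(j : ℤ)) = q.coeff j := by
  have h := coeff_ofPoly_mul (q.natDegree.lt_succ_self) (1 : LaurentSeries K) (-(j : ℤ))
  rw [mul_one] at h
  rw [h, Finset.sum_eq_single j]
  · simp
  · intro b _ hb
    rw [HahnSeries.coeff_one, if_neg (by omega), mul_zero]
  · intro hj
    rw [coeff_eq_zero_of_natDegree_lt (by simpa using hj), zero_mul]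

theorem coeff_ofPoly_pos (q : K[X]) {i : ℤ} (hi : 0 < i) : (ofPoly q).coeff i = 0 := by
  have h := coeff_ofPoly_mul (q.natDegree.lt_succ_self) (1 : LaurentSeries K) i
  rw [mul_one] at h
  rw [h]
  refine Finset.sum_eq_zero fun j _ => ?_
  rw [HahnSeries.coeff_one, if_neg (by omega), mul_zero]

theorem coeff_ofPoly_of_lt (q : K[X]) {i : ℤ} (hi : i < -(q.natDegree : ℤ)) :
    (ofPoly q).coeff i = 0 := by
  obtain ⟨j, rfl⟩ : ∃ j : ℕ, i = -(j : ℤ) := ⟨i.natAbs, by omega⟩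
  rw [coeff_ofPoly_neg, coeff_eq_zero_of_natDegree_lt (by omega)]

theorem ofPoly_injective : Function.Injective (ofPoly : K[X] → LaurentSeries K) := by
  intro p q h
  ext j
  rw [← coeff_ofPoly_neg, h, coeff_ofPoly_neg]

theorem ofPoly_eq_zero {q : K[X]} : ofPoly q = 0 ↔ q = 0 :=
  map_eq_zero_iff _ ofPoly_injective

theorem order_ofPoly (q : K[X]) : (ofPoly q).order = -(q.natDegree : ℤ) := by
  by_cases hq : q = 0
  · simp [hq]
  refine le_antisymm (HahnSeries.order_le_of_coeff_ne_zero ?_) ?_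
  · rw [coeff_ofPoly_neg]
    exact leadingCoeff_ne_zero.mpr hq
  · by_contra! h
    exact HahnSeries.coeff_order_eq_zero.not.mpr (ofPoly_eq_zero.not.mpr hq)
      (coeff_ofPoly_of_lt q h)

/-- A polynomial all of whose terms of nonnegative degree vanish is zero. -/
theorem eq_zero_of_coeff_ofPoly {q : K[X]} (h : ∀ i : ℤ, i ≤ 0 → (ofPoly q).coeff i = 0) :
    q = 0 := by
  ext j
  rw [← coeff_ofPoly_neg, h _ (by omega), coeff_zero]

theorem coeff_polyPart (α : LaurentSeries K) (j : ℕ) :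
    (polyPart α).coeff j = α.coeff (-(j : ℤ)) := by
  rw [polyPart, finsetSum_coeff]
  by_cases hj : j < (-α.order).toNat + 1
  · rw [Finset.sum_eq_single j]
    · simp
    · intro b _ hb
      rw [coeff_monomial, if_neg hb]
    · intro h
      exact absurd (Finset.mem_range.mpr hj) h
  · rw [HahnSeries.coeff_eq_zero_of_lt_order (by omega)]
    refine Finset.sum_eq_zero fun b hb => ?_
    rw [coeff_monomial, if_neg (by rw [Finset.mem_range] at hb; omega)]

theorem coeff_sub_polyPart (α : LaurentSeries K) {i : ℤ} (hi : i ≤ 0) :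
    (α - ofPoly (polyPart α)).coeff i = 0 := by
  obtain ⟨j, rfl⟩ : ∃ j : ℕ, i = -(j : ℤ) := ⟨i.natAbs, by omega⟩
  rw [HahnSeries.coeff_sub, coeff_ofPoly_neg, coeff_polyPart, sub_self]

theorem natDegree_polyPart {α : LaurentSeries K} (h : α.order ≤ 0) :
    ((polyPart α).natDegree : ℤ) = -α.order := by
  by_cases hα : α = 0
  · subst hα
    have : polyPart (0 : LaurentSeries K) = 0 := by ext j; simp [coeff_polyPart]
    simp [this]
  obtain ⟨n, hn⟩ : ∃ n : ℕ, α.order = -(n : ℤ) := ⟨α.order.natAbs, by omega⟩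
  rw [hn, neg_neg, Nat.cast_inj]
  refine natDegree_eq_of_le_of_coeff_ne_zero ?_ ?_
  · rw [natDegree_le_iff_coeff_eq_zero]
    intro j hj
    rw [coeff_polyPart, HahnSeries.coeff_eq_zero_of_lt_order (by omega)]
  · rw [coeff_polyPart, ← hn]
    exact HahnSeries.coeff_order_eq_zero.not.mpr hα

/-- The product of a series of order `≥ a` and one of order `≥ b` has order `≥ a + b`. -/
theorem coeff_mul_eq_zero_of_lt {α β : LaurentSeries K} {a b : ℤ} (ha : ∀ i < a, α.coeff i = 0)
    (hb : ∀ i < b, β.coeff i = 0) {i : ℤ} (hi : i < a + b) : (α * β).coeff i = 0 := by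
  rw [HahnSeries.coeff_mul]
  refine Finset.sum_eq_zero fun x hx => ?_
  rw [Finset.mem_antidiagonal] at hx
  obtain h | h : x.1 < a ∨ x.2 < b := by omega
  · rw [ha _ h, zero_mul]
  · rw [hb _ h, mul_zero]

theorem order_inv {α : LaurentSeries K} (h : α ≠ 0) : (α⁻¹).order = -α.order := by
  have h1 := HahnSeries.order_mul h (inv_ne_zero h)
  rw [mul_inv_cancel₀ h, HahnSeries.order_one] at h1
  omega

theorem le_order_of_coeff {α : LaurentSeries K} (hα : α ≠ 0) {a : ℤ}
    (h : ∀ i < a, α.coeff i = 0) : a ≤ α.order := by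
  by_contra! h'
  exact HahnSeries.coeff_order_eq_zero.not.mpr hα (h _ h')

/-! ### Continued fraction expansions of irrational series -/

/-- `α` is not a quotient of polynomials. -/
def Irrat (α : LaurentSeries K) : Prop :=
  ∀ p q : K[X], q ≠ 0 → ofPoly q * α - ofPoly p ≠ 0

theorem Irrat.sub_polyPart_ne_zero {α : LaurentSeries K} (h : Irrat α) :
    α - ofPoly (polyPart α) ≠ 0 := by
  simpa using h (polyPart α) 1 one_ne_zero

theorem Irrat.inv_sub_polyPart {α : LaurentSeries K} (h : Irrat α) :
    Irrat (α - ofPoly (polyPart α))⁻¹ := by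
  intro p q hq h0
  have h1 := h.sub_polyPart_ne_zero
  have h2 : ofPoly q = ofPoly p * (α - ofPoly (polyPart α)) := by
    rw [sub_eq_zero] at h0
    rw [← h0, mul_assoc, inv_mul_cancel₀ h1, mul_one]
  have hp : p ≠ 0 := by
    rintro rfl
    rw [map_zero, zero_mul, ofPoly_eq_zero] at h2
    exact hq h2
  refine h (p * polyPart α + q) p hp ?_
  rw [map_add, map_mul, h2]
  ring

theorem Irrat.completeQuotient {α : LaurentSeries K} (h : Irrat α) (n : ℕ) :
    Irrat (completeQuotient α n) := by
  induction n with
  | zero => exact h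
  | succ n ih => exact ih.inv_sub_polyPart

theorem Irrat.completeQuotient_ne_zero {α : LaurentSeries K} (h : Irrat α) (n : ℕ) :
    PolyCF.completeQuotient α n ≠ 0 := by
  simpa using h.completeQuotient n 0 1 one_ne_zero

theorem Irrat.order_completeQuotient {α : LaurentSeries K} (h : Irrat α) (n : ℕ) :
    (PolyCF.completeQuotient α (n + 1)).order < 0 := by
  have h1 := (h.completeQuotient n).sub_polyPart_ne_zero
  rw [PolyCF.completeQuotient, order_inv h1]
  have := le_order_of_coeff h1 (a := 1) fun i hi => coeff_sub_polyPart _ (by omega)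
  omega

theorem Irrat.natDegree_partialQuotient {α : LaurentSeries K} (h : Irrat α) (n : ℕ) :
    ((partialQuotient α (n + 1)).natDegree : ℤ) = -(PolyCF.completeQuotient α (n + 1)).order :=
  natDegree_polyPart (h.order_completeQuotient n).le

theorem Irrat.natDegree_partialQuotient_pos {α : LaurentSeries K} (h : Irrat α) (n : ℕ) :
    0 < (partialQuotient α (n + 1)).natDegree := by
  have h1 := h.natDegree_partialQuotient n
  have h2 := h.order_completeQuotient n
  omega

theorem Irrat.natDegree_convDen {α : LaurentSeries K} (h : Irrat α) (n : ℕ) :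
    convDen α n ≠ 0 ∧
      (convDen α (n + 1)).natDegree
        = (partialQuotient α (n + 1)).natDegree + (convDen α n).natDegree := by
  induction n with
  | zero => simp [convDen]
  | succ n ih =>
    have ha := h.natDegree_partialQuotient_pos n
    have hb : 0 < (partialQuotient α (n + 2)).natDegree := h.natDegree_partialQuotient_pos (n + 1)
    have h0 : convDen α (n + 1) ≠ 0 := by
      intro h0
      rw [h0, natDegree_zero] at ih
      omega
    refine ⟨h0, ?_⟩
    have ha0 : partialQuotient α (n + 2) ≠ 0 := by
      intro h0
      rw [h0, natDegree_zero] at hb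
      omega
    have hm := natDegree_mul ha0 h0
    rw [convDen, natDegree_add_eq_left_of_natDegree_lt (by omega), hm]

theorem Irrat.convDen_ne_zero {α : LaurentSeries K} (h : Irrat α) (n : ℕ) : convDen α n ≠ 0 :=
  (h.natDegree_convDen n).1

theorem Irrat.le_natDegree_convDen {α : LaurentSeries K} (h : Irrat α) (n : ℕ) :
    n ≤ (convDen α n).natDegree := by
  induction n with
  | zero => exact Nat.zero_le _
  | succ n ih =>
    have h1 := (h.natDegree_convDen n).2
    have h2 := h.natDegree_partialQuotient_pos n
    omega

theorem conv_det (α : LaurentSeries K) (n : ℕ) :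
    convNum α (n + 1) * convDen α n - convNum α n * convDen α (n + 1) = (-1) ^ n := by
  induction n with
  | zero => simp [convNum, convDen]; ring
  | succ n ih => rw [convNum, convDen, pow_succ, ← ih]; ring

theorem isCoprime_conv (α : LaurentSeries K) (n : ℕ) :
    IsCoprime (convNum α n) (convDen α n) := by
  have h := conv_det α n
  have h2 : ((-1 : K[X]) ^ n) * (-1) ^ n = 1 := by rw [← mul_pow]; simp
  refine ⟨-(-1) ^ n * convDen α (n + 1), (-1) ^ n * convNum α (n + 1), ?_⟩
  linear_combination (-1) ^ n * h + h2

/-- The error `q_n α - p_n`. -/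
theorem Irrat.error_mul {α : LaurentSeries K} (h : Irrat α) (n : ℕ) :
    (ofPoly (convDen α (n + 1)) * α - ofPoly (convNum α (n + 1)))
        * PolyCF.completeQuotient α (n + 2)
      = -(ofPoly (convDen α n) * α - ofPoly (convNum α n)) := by
  have key : ∀ m, (PolyCF.completeQuotient α m - ofPoly (partialQuotient α m))
      * PolyCF.completeQuotient α (m + 1) = 1 := fun m =>
    mul_inv_cancel₀ (h.completeQuotient m).sub_polyPart_ne_zero
  induction n with
  | zero =>
    have h0 := key 0
    have h1 := key 1
    simp only [convDen, convNum, map_one, map_add, map_mul, PolyCF.completeQuotient.eq_1 α] at h0 ⊢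
    linear_combination (-(α - ofPoly (partialQuotient α 0))) * h1
      + PolyCF.completeQuotient α 2 * h0
  | succ n ih =>
    have h1 := key (n + 2)
    rw [convDen, convNum]
    simp only [map_add, map_mul]
    linear_combination PolyCF.completeQuotient α (n + 3) * ih
      - (ofPoly (convDen α (n + 1)) * α - ofPoly (convNum α (n + 1))) * h1

/-- By `Irrat.error_mul`, passing to the next error divides by a complete quotient of order `-deg
a_{n+2}`, so the order grows exactly as the degree of the denominators does. -/
theorem Irrat.order_error {α : LaurentSeries K} (h : Irrat α) (n : ℕ) :
    (ofPoly (convDen α n) * α - ofPoly (convNum α n)).order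
      = ((convDen α (n + 1)).natDegree : ℤ) := by
  induction n with
  | zero =>
    have h1 := h.natDegree_partialQuotient 0
    have h2 := h.sub_polyPart_ne_zero
    have h3 := order_inv h2
    have h4 : (PolyCF.completeQuotient α (0 + 1)).order
        = -(α - ofPoly (partialQuotient α 0)).order := h3
    simp only [convDen, convNum, map_one, one_mul]
    rw [zero_add] at h1 h4
    rw [h1, h4, neg_neg]
  | succ n ih =>
    have h1 := HahnSeries.order_mul (h (convNum α (n + 1)) _ (h.convDen_ne_zero (n + 1)))
      (h.completeQuotient_ne_zero (n + 2))
    rw [h.error_mul, HahnSeries.order_neg, ih] at h1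
    have h2 : ((partialQuotient α (n + 2)).natDegree : ℤ)
      = -(PolyCF.completeQuotient α (n + 2)).order := h.natDegree_partialQuotient (n + 1)
    have h3 := (h.natDegree_convDen (n + 1)).2
    rw [h3]
    push_cast
    linarith

/-- **Legendre's theorem**: a sufficiently good approximation of `α` is a convergent. -/
theorem Irrat.exists_eq_mul_conv {α : LaurentSeries K} (h : Irrat α) {p u : K[X]}
    (hu : u ≠ 0) (hpu : ∀ i ≤ (u.natDegree : ℤ), (ofPoly u * α - ofPoly p).coeff i = 0) :
    ∃ (n : ℕ) (c : K[X]), u = c * convDen α n ∧ p = c * convNum α n := by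
  have hex : ∃ n, u.natDegree < (convDen α (n + 1)).natDegree :=
    ⟨u.natDegree, h.le_natDegree_convDen (u.natDegree + 1)⟩
  classical
  -- The index with `deg q_n ≤ deg u < deg q_{n+1}`; only this convergent can equal `p / u`.
  obtain ⟨n, hn, hmin⟩ : ∃ n, u.natDegree < (convDen α (n + 1)).natDegree ∧
      (convDen α n).natDegree ≤ u.natDegree := by
    refine ⟨Nat.find hex, Nat.find_spec hex, ?_⟩
    rcases hk : Nat.find hex with _ | k
    · simp [convDen]
    · exact not_lt.mp (Nat.find_min hex (m := k) (by omega))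
  have herr := h.order_error n
  -- Written through the two errors, this polynomial is a difference of two series of positive
  -- order, so it is zero.
  have hz : p * convDen α n - u * convNum α n = 0 := by
    refine eq_zero_of_coeff_ofPoly fun i hi => ?_
    have : ofPoly (p * convDen α n - u * convNum α n)
        = ofPoly u * (ofPoly (convDen α n) * α - ofPoly (convNum α n))
          - ofPoly (convDen α n) * (ofPoly u * α - ofPoly p) := by
      simp only [map_sub, map_mul]; ring
    rw [this, HahnSeries.coeff_sub, coeff_mul_eq_zero_of_lt (a := -(u.natDegree : ℤ))
      (b := (convDen α (n + 1)).natDegree) (fun i hi => coeff_ofPoly_of_lt _ hi)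
      (fun i hi => HahnSeries.coeff_eq_zero_of_lt_order (by omega)) (by omega),
      coeff_mul_eq_zero_of_lt (a := -((convDen α n).natDegree : ℤ))
      (b := u.natDegree + 1) (fun i hi => coeff_ofPoly_of_lt _ hi)
      (fun i hi => hpu i (by omega)) (by omega), sub_zero]
  have hdvd : convDen α n ∣ u := by
    refine (isCoprime_conv α n).symm.dvd_of_dvd_mul_right ?_
    exact ⟨p, by linear_combination -hz⟩
  obtain ⟨c, rfl⟩ := hdvd
  refine ⟨n, c, mul_comm _ _, ?_⟩
  refine mul_left_cancel₀ (h.convDen_ne_zero n) ?_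
  linear_combination hz

/-! ### Bounded partial quotients -/

/-- Every fraction `p / q` approximates `α` to order at most `2 deg q + m`. -/
def ApproxBound (α : LaurentSeries K) (m : ℕ) : Prop :=
  ∀ p q : K[X], q ≠ 0 →
    ∃ i : ℤ, i ≤ q.natDegree + m ∧ (ofPoly q * α - ofPoly p).coeff i ≠ 0

theorem ApproxBound.irrat {α : LaurentSeries K} {m : ℕ} (h : ApproxBound α m) : Irrat α := by
  intro p q hq h0
  obtain ⟨i, -, hi⟩ := h p q hq
  rw [h0] at hi
  exact hi rfl

theorem ApproxBound.mono {α : LaurentSeries K} {m m' : ℕ} (h : ApproxBound α m) (hm : m ≤ m') :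
    ApproxBound α m' := by
  intro p q hq
  obtain ⟨i, hi, hi'⟩ := h p q hq
  exact ⟨i, by omega, hi'⟩

theorem ApproxBound.natDegree_partialQuotient_le {α : LaurentSeries K} {m : ℕ}
    (h : ApproxBound α m) (n : ℕ) : (partialQuotient α (n + 1)).natDegree ≤ m := by
  obtain ⟨i, hi, hi'⟩ := h (convNum α n) (convDen α n) (h.irrat.convDen_ne_zero n)
  have h1 := HahnSeries.order_le_of_coeff_ne_zero hi'
  have h2 := h.irrat.order_error n
  have h3 := (h.irrat.natDegree_convDen n).2
  omega

theorem ApproxBound.supDeg_eq_one {α : LaurentSeries K} (h : ApproxBound α 1) :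
    supDeg α = 1 := by
  have h1 : ∀ n, (partialQuotient α (n + 1)).natDegree = 1 := fun n =>
    le_antisymm (h.natDegree_partialQuotient_le n) (h.irrat.natDegree_partialQuotient_pos n)
  simp [supDeg, h1]

theorem ApproxBound.limsupDeg_eq_one {α : LaurentSeries K} (h : ApproxBound α 1) :
    limsupDeg α = 1 := by
  have h1 : ∀ n, (partialQuotient α (n + 1)).natDegree = 1 := fun n =>
    le_antisymm (h.natDegree_partialQuotient_le n) (h.irrat.natDegree_partialQuotient_pos n)
  -- The shift discards `a_0`, whose degree is not controlled.
  rw [limsupDeg, ← Filter.limsup_nat_add _ 1]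
  simp [h1]

/-- Square roots of nonsquare polynomials are badly approximable. -/
theorem IsSqrt.approxBound {s : LaurentSeries K} {D : K[X]} (hs : IsSqrt s D)
    (hD : ¬ IsSquare D) {d : ℕ} (hd : D.natDegree ≤ 2 * d) : ApproxBound s d := by
  intro p q hq
  by_contra! H
  have hs0 : s ≠ 0 := by
    rintro rfl
    have : D = 0 := by
      rw [← ofPoly_eq_zero, ← hs]; simp
    exact hD ⟨0, by simp [this]⟩
  have hord : -(d : ℤ) ≤ s.order := by
    have h1 : (s ^ 2).order = -(D.natDegree : ℤ) := by
      rw [show s ^ 2 = ofPoly D from hs, order_ofPoly]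
    rw [sq, HahnSeries.order_mul hs0 hs0] at h1
    omega
  set e := ofPoly q * s - ofPoly p with he
  have hqs : ∀ i < -(q.natDegree : ℤ) - d, (ofPoly q * s).coeff i = 0 := fun i hi =>
    coeff_mul_eq_zero_of_lt (a := -(q.natDegree : ℤ)) (b := -(d : ℤ))
      (fun i hi => coeff_ofPoly_of_lt _ hi)
      (fun i hi => HahnSeries.coeff_eq_zero_of_lt_order (by omega)) (by omega)
  -- The factorisation is `(qs - p)(qs + p)` with `qs + p = 2qs - e`; the orders are at least `deg q
  -- + d + 1` and `-deg q - d`, with positive sum.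
  have hz : D * q ^ 2 - p ^ 2 = 0 := by
    refine eq_zero_of_coeff_ofPoly fun i hi => ?_
    have : ofPoly (D * q ^ 2 - p ^ 2) = e * (ofPoly q * s + ofPoly q * s - e) := by
      simp only [map_sub, map_mul, map_pow, he, ← show s ^ 2 = ofPoly D from hs]; ring
    rw [this]
    refine coeff_mul_eq_zero_of_lt (a := q.natDegree + d + 1) (b := -(q.natDegree : ℤ) - d)
      (fun i hi => H i (by omega)) (fun i hi => ?_) (by omega)
    rw [HahnSeries.coeff_sub, HahnSeries.coeff_add, hqs i hi, H i (by omega)]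
    simp
  refine hD ?_
  have hdvd : q ∣ p := by
    rw [← IsIntegrallyClosed.pow_dvd_pow_iff two_ne_zero]
    exact ⟨D, by linear_combination -hz⟩
  obtain ⟨c, rfl⟩ := hdvd
  refine ⟨c, mul_left_cancel₀ (pow_ne_zero 2 hq) ?_⟩
  linear_combination hz

/-- Multiplication by `T - a` lowers the approximation exponent if no convergent has `a` as a
root. -/
theorem ApproxBound.X_sub_C_mul {α : LaurentSeries K} {m m' : ℕ} (h : ApproxBound α m) {a : K}
    (ha : ∀ n, ¬ (convDen α n).IsRoot a) (hm : m ≤ m' + 1) (hm' : 1 ≤ m') :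
    ApproxBound (ofPoly (X - C a) * α) m' := by
  intro p q hq
  by_contra! H
  have hX : (X - C a : K[X]) ≠ 0 := X_sub_C_ne_zero a
  have hdeg : ((X - C a) * q).natDegree = q.natDegree + 1 := by
    rw [natDegree_mul hX hq, natDegree_X_sub_C, add_comm]
  have hcomm : ofPoly ((X - C a) * q) * α - ofPoly p
      = ofPoly q * (ofPoly (X - C a) * α) - ofPoly p := by
    rw [map_mul]; ring
  -- The denominator `(X - a)q` has degree one more than `q`, so Legendre's criterion needs `m' ≥
  -- 1`.
  obtain ⟨n, c, h1, h2⟩ := h.irrat.exists_eq_mul_conv (p := p) (mul_ne_zero hX hq)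
    (fun i hi => by rw [hcomm]; exact H i (by omega))
  have hc0 : c ≠ 0 := by
    rintro rfl
    rw [zero_mul] at h1
    exact mul_ne_zero hX hq h1
  have hcX : (X - C a) ∣ c := by
    have h3 : (X - C a) ∣ c * convDen α n := ⟨q, h1.symm⟩
    refine ((prime_X_sub_C a).dvd_or_dvd h3).resolve_right fun h4 => ha n ?_
    exact dvd_iff_isRoot.mp h4
  have hcd : 1 ≤ c.natDegree := by
    have := natDegree_le_of_dvd hcX hc0
    rwa [natDegree_X_sub_C] at this
  have hd1 := natDegree_mul hc0 (h.irrat.convDen_ne_zero n)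
  rw [← h1, hdeg] at hd1
  obtain ⟨i, hi, hi'⟩ := h (convNum α n) (convDen α n) (h.irrat.convDen_ne_zero n)
  have ho1 := HahnSeries.order_le_of_coeff_ne_zero hi'
  have hne := h.irrat (convNum α n) _ (h.irrat.convDen_ne_zero n)
  -- Cancelling `c` lowers the degree of the denominator and raises the order of the error, a gain
  -- of `2 deg c ≥ 2` in the exponent, whereas passing from `q` to `(X - a)q` cost only one. The net
  -- gain contradicts `m ≤ m' + 1`.
  have ho2 : (ofPoly q * (ofPoly (X - C a) * α) - ofPoly p).order
      = -(c.natDegree : ℤ) + (ofPoly (convDen α n) * α - ofPoly (convNum α n)).order := by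
    rw [← order_ofPoly, ← HahnSeries.order_mul (ofPoly_eq_zero.not.mpr hc0) hne, ← hcomm, h1, h2,
      map_mul, map_mul]
    ring_nf
  have hne' : ofPoly q * (ofPoly (X - C a) * α) - ofPoly p ≠ 0 := by
    rw [← hcomm]
    exact h.irrat _ _ (mul_ne_zero hX hq)
  have ho3 := le_order_of_coeff hne' (a := q.natDegree + m' + 1) fun i hi => H i (by omega)
  omega

end

/-! ### Functoriality in the coefficient field -/

section Map

/-- The ring homomorphism of Laurent series induced by a homomorphism of the coefficients. -/
noncomputable def mapSeries {R S : Type*} [CommRing R] [CommRing S] (f : R →+* S) :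
    LaurentSeries R →+* LaurentSeries S where
  toFun α := α.map f
  map_one' := HahnSeries.map_one f.toMonoidWithZeroHom
  map_zero' := HahnSeries.map_zero (f : ZeroHom R S)
  map_add' _ _ := HahnSeries.map_add (f : R →+ S)
  map_mul' _ _ := HahnSeries.map_mul (f : R →ₙ+* S)

@[simp]
theorem coeff_mapSeries {R S : Type*} [CommRing R] [CommRing S] (f : R →+* S)
    (α : LaurentSeries R) (i : ℤ) : (mapSeries f α).coeff i = f (α.coeff i) := rfl

variable {F K : Type*} [Field F] [Field K] (f : F →+* K)

theorem mapSeries_ofPoly (p : F[X]) : mapSeries f (ofPoly p) = ofPoly (p.map f) := by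
  ext i
  rw [coeff_mapSeries]
  rcases lt_or_ge 0 i with hi | hi
  · rw [coeff_ofPoly_pos _ hi, coeff_ofPoly_pos _ hi, map_zero]
  · obtain ⟨j, rfl⟩ : ∃ j : ℕ, i = -(j : ℤ) := ⟨i.natAbs, by omega⟩
    rw [coeff_ofPoly_neg, coeff_ofPoly_neg, coeff_map]

theorem polyPart_mapSeries (α : LaurentSeries F) :
    polyPart (mapSeries f α) = (polyPart α).map f := by
  ext j
  rw [coeff_polyPart, coeff_map, coeff_polyPart, coeff_mapSeries]

theorem completeQuotient_mapSeries (α : LaurentSeries F) (n : ℕ) :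
    completeQuotient (mapSeries f α) n = mapSeries f (completeQuotient α n) := by
  induction n with
  | zero => rfl
  | succ n ih =>
    rw [completeQuotient, completeQuotient, ih, polyPart_mapSeries, ← mapSeries_ofPoly, map_inv₀,
      map_sub]

theorem partialQuotient_mapSeries (α : LaurentSeries F) (n : ℕ) :
    partialQuotient (mapSeries f α) n = (partialQuotient α n).map f := by
  rw [partialQuotient, completeQuotient_mapSeries, polyPart_mapSeries, partialQuotient]

theorem convDen_mapSeries (α : LaurentSeries F) (n : ℕ) :
    convDen (mapSeries f α) n = (convDen α n).map f := by
  induction n using Nat.strong_induction_on with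
  | _ n ih =>
    match n with
    | 0 => simp [convDen]
    | 1 => simp [convDen, partialQuotient_mapSeries]
    | n + 2 =>
      rw [convDen, convDen, ih n (by omega), ih (n + 1) (by omega), partialQuotient_mapSeries]
      simp

end Map

/-! ### Reduction modulo a valuation -/

section Reduction

variable {F Γ : Type*} [Field F] [LinearOrderedCommGroupWithZero Γ] (v : Valuation F Γ)

/-- A series whose coefficients are integral, as a series over the valuation ring. -/
def liftSeries (α : LaurentSeries F) (h : ∀ i, v (α.coeff i) ≤ 1) :
    LaurentSeries v.valuationSubring where
  coeff i := ⟨α.coeff i, h i⟩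
  isPWO_support' := α.isPWO_support.mono fun i hi => by
    rw [HahnSeries.mem_support]
    intro h0
    exact hi (Subtype.ext h0)

/-- A polynomial whose coefficients are integral, as a polynomial over the valuation ring. -/
theorem exists_lift_poly (q : F[X]) (h : ∀ i, v (q.coeff i) ≤ 1) :
    ∃ Q : v.valuationSubring[X], ∀ i, ((Q.coeff i : v.valuationSubring) : F) = q.coeff i := by
  refine ⟨∑ i ∈ Finset.range (q.natDegree + 1), monomial i ⟨q.coeff i, h i⟩, fun i => ?_⟩
  simp only [finsetSum_coeff, coeff_monomial, Finset.sum_ite_eq', Finset.mem_range]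
  split_ifs with hi
  · rfl
  · rw [coeff_eq_zero_of_natDegree_lt (by omega)]; rfl

theorem residue_eq_zero_of_lt {x : v.valuationSubring} (hx : v (x : F) < 1) :
    IsLocalRing.residue v.valuationSubring x = 0 := by
  rw [IsLocalRing.residue_eq_zero_iff, IsLocalRing.mem_maximalIdeal, mem_nonunits_iff]
  rintro h
  obtain ⟨y, hy⟩ := h.exists_right_inv
  have h1 : v (x : F) * v (y : F) = 1 := by
    rw [← map_mul, ← map_one v]
    exact congrArg v (congrArg Subtype.val hy)
  have h2 : v (y : F) ≤ 1 := y.2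
  have h3 : v (x : F) * v (y : F) < 1 := mul_lt_one_of_lt_of_le hx h2
  exact h3.ne h1

theorem residue_ne_zero {x : v.valuationSubring} (hx : v (x : F) = 1) :
    IsLocalRing.residue v.valuationSubring x ≠ 0 := by
  have hx0 : (x : F) ≠ 0 := by
    intro h
    rw [h, map_zero] at hx
    exact zero_ne_one hx
  rw [IsLocalRing.residue_ne_zero_iff_isUnit]
  refine IsUnit.of_mul_eq_one ⟨(x : F)⁻¹, ?_⟩ (Subtype.ext (mul_inv_cancel₀ hx0))
  change v (x : F)⁻¹ ≤ 1
  rw [map_inv₀, hx, inv_one]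

theorem valuation_coeff_ofPoly_le {D : F[X]} (hD : ∀ i, v (D.coeff i) ≤ 1) (i : ℤ) :
    v ((ofPoly D).coeff i) ≤ 1 := by
  rcases lt_or_ge 0 i with hi | hi
  · rw [coeff_ofPoly_pos _ hi, map_zero]; exact zero_le_one
  · obtain ⟨j, rfl⟩ : ∃ j : ℕ, i = -(j : ℤ) := ⟨i.natAbs, by omega⟩
    rw [coeff_ofPoly_neg]; exact hD j

/-- The `n`-th coefficient of `f * f` is `2 f_0 f_n` plus products of earlier coefficients. Since
`2` and `f_0` have valuation one, integrality propagates by induction. -/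
theorem valuation_coeff_le_of_mul_self {f : PowerSeries F} (h2 : v 2 = 1)
    (h0 : v (PowerSeries.coeff 0 f) = 1) (hf : ∀ n, v (PowerSeries.coeff n (f * f)) ≤ 1) (n : ℕ) :
    v (PowerSeries.coeff n f) ≤ 1 := by
  induction n using Nat.strong_induction_on with
  | _ n ih =>
    rcases Nat.eq_zero_or_pos n with rfl | hn
    · exact h0.le
    have h1 := hf n
    have hmem1 : ((0, n) : ℕ × ℕ) ∈ Finset.HasAntidiagonal.antidiagonal n := by simp
    have hmem2 : ((n, 0) : ℕ × ℕ) ∈ (Finset.HasAntidiagonal.antidiagonal n).erase (0, n) := by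
      simp; omega
    rw [PowerSeries.coeff_mul, ← Finset.add_sum_erase _ _ hmem1,
      ← Finset.add_sum_erase _ _ hmem2] at h1
    set S := ∑ x ∈ ((Finset.HasAntidiagonal.antidiagonal n).erase (0, n)).erase (n, 0),
      PowerSeries.coeff x.1 f * PowerSeries.coeff x.2 f with hS
    have hSv : v S ≤ 1 := by
      refine v.map_sum_le fun x hx => ?_
      simp only [Finset.mem_erase, Finset.HasAntidiagonal.mem_antidiagonal, ne_eq, Prod.ext_iff] at hx
      rw [map_mul]
      exact mul_le_one' (ih _ (by omega)) (ih _ (by omega))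
    have h3 : v (2 * PowerSeries.coeff 0 f * PowerSeries.coeff n f) ≤ 1 := by
      refine le_trans (le_of_eq ?_) (v.map_sub_le h1 hSv)
      congr 1
      ring
    rwa [map_mul, map_mul, h2, h0, one_mul, one_mul] at h3

theorem IsSqrt.ne_zero {s : LaurentSeries F} {D : F[X]} (hs : IsSqrt s D) (hD : D ≠ 0) :
    s ≠ 0 := by
  rintro rfl
  refine hD (ofPoly_eq_zero.mp ?_)
  rw [← show (0 : LaurentSeries F) ^ 2 = ofPoly D from hs, zero_pow two_ne_zero]

theorem IsSqrt.order_eq {s : LaurentSeries F} {D : F[X]} (hs : IsSqrt s D) (hD : D ≠ 0)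
    {d : ℕ} (hd : D.natDegree = 2 * d) : s.order = -(d : ℤ) := by
  have h1 : (s ^ 2).order = -(D.natDegree : ℤ) := by
    rw [show s ^ 2 = ofPoly D from hs, order_ofPoly]
  rw [sq, HahnSeries.order_mul (hs.ne_zero hD) (hs.ne_zero hD)] at h1
  omega

theorem IsSqrt.coeff_sq {s : LaurentSeries F} {D : F[X]} (hs : IsSqrt s D) (hD : D ≠ 0)
    {d : ℕ} (hd : D.natDegree = 2 * d) : s.coeff (-(d : ℤ)) ^ 2 = D.leadingCoeff := by
  have h1 := HahnSeries.coeff_mul_order_add_order s s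
  rw [← sq s, show s ^ 2 = ofPoly D from hs, HahnSeries.leadingCoeff_eq, hs.order_eq hD hd,
    show -(d : ℤ) + -(d : ℤ) = -((D.natDegree : ℕ) : ℤ) by rw [hd]; push_cast; ring,
    coeff_ofPoly_neg] at h1
  rw [sq, ← h1]; rfl

variable {v} in
theorem valuation_eq_one_of_sq {x : F} (h : v (x ^ 2) = 1) : v x = 1 := by
  rw [map_pow] at h
  rcases lt_trichotomy (v x) 1 with h1 | h1 | h1
  · exact absurd h (pow_lt_one₀ zero_le h1 two_ne_zero).ne
  · exact h1
  · exact absurd h (one_lt_pow₀ h1 two_ne_zero).ne'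

theorem IsSqrt.valuation_coeff_le {s : LaurentSeries F} {D : F[X]} (hs : IsSqrt s D)
    {d : ℕ} (hd : D.natDegree = 2 * d) (h2 : v 2 = 1) (hlc : v D.leadingCoeff = 1)
    (hD : ∀ i, v (D.coeff i) ≤ 1) (i : ℤ) : v (s.coeff i) ≤ 1 := by
  have hD0 : D ≠ 0 := by
    rintro rfl
    simp at hlc
  have hord := hs.order_eq hD0 hd
  rcases lt_or_ge i (-(d : ℤ)) with hi | hi
  · rw [HahnSeries.coeff_eq_zero_of_lt_order (by omega), map_zero]; exact zero_le_one
  obtain ⟨n, rfl⟩ : ∃ n : ℕ, i = s.order + n := ⟨(i + d).toNat, by omega⟩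
  rw [← LaurentSeries.powerSeriesPart_coeff]
  refine valuation_coeff_le_of_mul_self v h2 ?_ (fun n => ?_) n
  · rw [LaurentSeries.powerSeriesPart_coeff, hord]
    refine valuation_eq_one_of_sq ?_
    rw [Nat.cast_zero, add_zero, hs.coeff_sq hD0 hd, hlc]
  · rw [← LaurentSeries.coeff_coe_powerSeries]
    have hsing : HahnSeries.single (-s.order + -s.order) (1 : F)
        = HahnSeries.single (-s.order) 1 * HahnSeries.single (-s.order) 1 := by
      rw [HahnSeries.single_mul_single, one_mul]
    have : HahnSeries.ofPowerSeries ℤ F (s.powerSeriesPart * s.powerSeriesPart)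
        = HahnSeries.single (-s.order + -s.order) 1 * ofPoly D := by
      rw [map_mul, LaurentSeries.ofPowerSeries_powerSeriesPart,
        ← show s ^ 2 = ofPoly D from hs, hsing]
      ring
    rw [this, HahnSeries.coeff_single_mul, one_mul]
    exact valuation_coeff_ofPoly_le v hD _

/-! ### Good reduction and Liouville's bound over the residue field -/

/-- If `S² = E² + R`, then `(S - E)(S + E) = R`, but the factors differ by `2E`, so one of them has
degree at least `deg E > deg R`. -/
theorem not_isSquare_sq_add {k : Type*} [Field k] (h2 : (2 : k) ≠ 0) {E R : k[X]} (hR : R ≠ 0)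
    (hd : R.natDegree < E.natDegree) : ¬ IsSquare (E ^ 2 + R) := by
  rintro ⟨S, hS⟩
  have hm : (S - E) * (S + E) = R := by linear_combination -hS
  have h1 : S - E ≠ 0 := by rintro h; rw [h, zero_mul] at hm; exact hR hm.symm
  have h3 : S + E ≠ 0 := by rintro h; rw [h, mul_zero] at hm; exact hR hm.symm
  have h4 := natDegree_mul h1 h3
  rw [hm] at h4
  have h5 : (S + E) - (S - E) = C 2 * E := by
    rw [map_ofNat]; ring
  have h6 := natDegree_sub_le (S + E) (S - E)
  rw [h5, natDegree_C_mul h2] at h6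
  rcases le_max_iff.mp h6 with h | h <;> omega

/-- `s = √D` has good reduction at the valuation `v`. -/
structure GoodReduction (s : LaurentSeries F) (D : F[X]) : Prop where
  two : v 2 = 1
  leadingCoeff : v D.leadingCoeff = 1
  coeff : ∀ i, v (D.coeff i) ≤ 1
  remainder : ∃ j, v ((D - polyPart s ^ 2).coeff j) = 1

/-- With `E` the polynomial part of `s`, one has `D - E² = (s - E)(s + E)`, with factors of order at
least `1` and `-d`. -/
theorem IsSqrt.natDegree_remainder_lt {s : LaurentSeries F} {D : F[X]} (hs : IsSqrt s D)
    {d : ℕ} (hd : D.natDegree = 2 * d) (hd0 : 0 < d) :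
    (D - polyPart s ^ 2).natDegree < d := by
  have hD0 : D ≠ 0 := by
    rintro rfl
    rw [natDegree_zero] at hd
    omega
  have hord := hs.order_eq hD0 hd
  refine Nat.lt_of_le_pred hd0 (natDegree_le_iff_coeff_eq_zero.mpr fun j hj => ?_)
  rw [Nat.pred_eq_sub_one] at hj
  have h1 : ofPoly (D - polyPart s ^ 2)
      = (s - ofPoly (polyPart s)) * (s + s - (s - ofPoly (polyPart s))) := by
    rw [map_sub, map_pow, ← show s ^ 2 = ofPoly D from hs]; ring
  rw [← coeff_ofPoly_neg, h1]
  refine coeff_mul_eq_zero_of_lt (a := 1) (b := -(d : ℤ))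
    (fun i hi => coeff_sub_polyPart _ (by omega)) (fun i hi => ?_) (by omega)
  rw [HahnSeries.coeff_sub, HahnSeries.coeff_add, coeff_sub_polyPart _ (by omega),
    HahnSeries.coeff_eq_zero_of_lt_order (by omega)]
  simp

variable {v} in
/-- The reduction of `D` is not a square. -/
theorem GoodReduction.not_isSquare {s : LaurentSeries F} {D : F[X]} (h : GoodReduction v s D)
    (hs : IsSqrt s D) {d : ℕ} (hd : D.natDegree = 2 * d) (hd0 : 0 < d)
    {Q : v.valuationSubring[X]} (hQ : ∀ i, ((Q.coeff i : v.valuationSubring) : F) = D.coeff i) :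
    ¬ IsSquare (Q.map (IsLocalRing.residue v.valuationSubring)) := by
  have hD0 : D ≠ 0 := by
    rintro rfl
    rw [natDegree_zero] at hd
    omega
  have hint := hs.valuation_coeff_le v hd h.two h.leadingCoeff h.coeff
  obtain ⟨E, hE⟩ := exists_lift_poly v (polyPart s) fun i => by
    rw [coeff_polyPart]; exact hint _
  have hmap : ∀ {P : v.valuationSubring[X]} {p : F[X]},
      (∀ i, ((P.coeff i : v.valuationSubring) : F) = p.coeff i) →
        P.map v.valuationSubring.subtype = p := by
    intro P p hP
    ext i
    rw [coeff_map, ← hP]; rfl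
  have hRco : ∀ j, (((Q - E ^ 2).coeff j : v.valuationSubring) : F)
      = (D - polyPart s ^ 2).coeff j := by
    intro j
    rw [← hmap hQ, ← hmap hE, ← Polynomial.map_pow, ← Polynomial.map_sub, coeff_map]
    rfl
  have hdR := hs.natDegree_remainder_lt hd hd0
  have hQE : Q = E ^ 2 + (Q - E ^ 2) := by ring
  have hEd : (E.map (IsLocalRing.residue v.valuationSubring)).natDegree = d := by
    refine natDegree_eq_of_le_of_coeff_ne_zero ?_ ?_
    · rw [natDegree_le_iff_coeff_eq_zero]
      intro j hj
      have : E.coeff j = 0 := by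
        refine Subtype.ext ?_
        rw [hE, coeff_polyPart, HahnSeries.coeff_eq_zero_of_lt_order
          (by rw [hs.order_eq hD0 hd]; omega)]
        rfl
      rw [coeff_map, this, map_zero]
    · rw [coeff_map]
      refine residue_ne_zero v (valuation_eq_one_of_sq ?_)
      rw [hE, coeff_polyPart, hs.coeff_sq hD0 hd, h.leadingCoeff]
  -- The reduction is `E² + R` with `deg E = d > deg R`, and `R` survives because `remainder`
  -- supplies a coefficient of valuation one.
  rw [hQE, Polynomial.map_add, Polynomial.map_pow]
  refine not_isSquare_sq_add ?_ ?_ ?_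
  · have : (2 : IsLocalRing.ResidueField v.valuationSubring)
        = IsLocalRing.residue v.valuationSubring 2 :=
      (map_ofNat _ 2).symm
    rw [this]
    exact residue_ne_zero v (by exact_mod_cast h.two)
  · obtain ⟨j, hj⟩ := h.remainder
    intro h0
    refine residue_ne_zero v (x := (Q - E ^ 2).coeff j) (by rw [hRco, hj]) ?_
    rw [← coeff_map, h0, coeff_zero]
  · rw [hEd]
    refine lt_of_le_of_lt (natDegree_map_le.trans ?_) hdR
    rw [natDegree_le_iff_coeff_eq_zero]
    intro j hj
    refine Subtype.ext ?_
    rw [hRco, coeff_eq_zero_of_natDegree_lt hj]; rfl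

variable {v} in
/-- If `s = √D` has good reduction, the primitive part of the denominator of a convergent loses at
most `d - 1` in its degree under reduction. -/
theorem GoodReduction.exists_dominant_coeff {s : LaurentSeries F} {D : F[X]}
    (h : GoodReduction v s D) (hs : IsSqrt s D) {d : ℕ} (hd : D.natDegree = 2 * d) (hd0 : 0 < d)
    {p q : F[X]} (hq : q ≠ 0)
    (hpq : ∀ i ≤ (q.natDegree : ℤ), (ofPoly q * s - ofPoly p).coeff i = 0) :
    ∃ i, q.natDegree < i + d ∧ q.coeff i ≠ 0 ∧ ∀ j, v (q.coeff j) ≤ v (q.coeff i) := by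
  have hint := hs.valuation_coeff_le v hd h.two h.leadingCoeff h.coeff
  obtain ⟨i₀, hi₀, hmax⟩ := Finset.exists_max_image q.support (fun j => v (q.coeff j))
    (support_nonempty.mpr hq)
  have hmax' : ∀ j, v (q.coeff j) ≤ v (q.coeff i₀) := fun j => by
    by_cases hj : j ∈ q.support
    · exact hmax j hj
    · rw [notMem_support_iff.mp hj, map_zero]; exact zero_le
  have hc : q.coeff i₀ ≠ 0 := mem_support_iff.mp hi₀
  have hvc : v (q.coeff i₀) ≠ 0 := (Valuation.ne_zero_iff v).mpr hc
  obtain ⟨Q, hQ⟩ := exists_lift_poly v (C (q.coeff i₀)⁻¹ * q) fun j => by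
    rw [coeff_C_mul, map_mul, map_inv₀]
    exact (inv_mul_le_one₀ (zero_lt_iff.mpr hvc)).mpr (hmax' j)
  obtain ⟨DA, hDA⟩ := exists_lift_poly v D h.coeff
  have hbar := h.not_isSquare hs hd hd0 hDA
  set sA := liftSeries v s hint
  set res := IsLocalRing.residue v.valuationSubring
  have hpj : ∀ j : ℕ, (C (q.coeff i₀)⁻¹ * p).coeff j
      = ∑ l ∈ Finset.range (q.natDegree + 1), (C (q.coeff i₀)⁻¹ * q).coeff l
          * s.coeff (-(j : ℤ) + l) := by
    intro j
    have h1 := hpq (-(j : ℤ)) (by omega)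
    rw [HahnSeries.coeff_sub, coeff_ofPoly_neg, sub_eq_zero,
      coeff_ofPoly_mul q.natDegree.lt_succ_self] at h1
    rw [coeff_C_mul, ← h1, Finset.mul_sum]
    exact Finset.sum_congr rfl fun l _ => by rw [coeff_C_mul, mul_assoc]
  -- No separate bound on `p` is needed: its coefficients are those of `q s` in nonnegative degrees,
  -- so scaling `q` to be integral makes `p` integral too.
  obtain ⟨P, hP⟩ := exists_lift_poly v (C (q.coeff i₀)⁻¹ * p) fun j => by
    rw [hpj]
    refine v.map_sum_le fun l _ => ?_
    rw [map_mul, ← hQ]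
    exact mul_le_one' (Q.coeff l).2 (hint _)
  have hQdeg : Q.natDegree ≤ q.natDegree := by
    rw [natDegree_le_iff_coeff_eq_zero]
    intro j hj
    refine Subtype.ext ?_
    rw [hQ, coeff_C_mul, coeff_eq_zero_of_natDegree_lt hj, mul_zero]; rfl
  have hsq : IsSqrt (mapSeries res sA) (DA.map res) := by
    have hA : ∀ i, (sA ^ 2).coeff i = if i ≤ 0 then DA.coeff (-i).toNat else 0 := by
      intro i
      refine Subtype.ext ?_
      have h1 : mapSeries v.valuationSubring.subtype (sA ^ 2) = ofPoly D := by
        rw [map_pow, ← show s ^ 2 = ofPoly D from hs]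
        rfl
      have h2 : (((sA ^ 2).coeff i : v.valuationSubring) : F) = (ofPoly D).coeff i := by
        rw [← h1]; rfl
      rw [h2]
      split_ifs with hi
      · rw [hDA, ← coeff_ofPoly_neg]
        congr 1
        omega
      · rw [coeff_ofPoly_pos _ (by omega)]; rfl
    rw [IsSqrt, ← map_pow]
    ext i
    rw [coeff_mapSeries, hA]
    split_ifs with hi
    · rw [← coeff_map, ← coeff_ofPoly_neg]
      congr 1
      omega
    · rw [coeff_ofPoly_pos _ (by omega), map_zero]
  have hDdeg : (DA.map res).natDegree ≤ 2 * d := by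
    refine natDegree_map_le.trans ?_
    rw [natDegree_le_iff_coeff_eq_zero]
    intro j hj
    refine Subtype.ext ?_
    rw [hDA, coeff_eq_zero_of_natDegree_lt (by omega)]; rfl
  have hQ0 : Q.map res ≠ 0 := by
    intro h0
    refine residue_ne_zero v (x := Q.coeff i₀) ?_ ?_
    · rw [hQ, coeff_C_mul, inv_mul_cancel₀ hc, map_one]
    · change res (Q.coeff i₀) = 0
      rw [← coeff_map, h0, coeff_zero]
  obtain ⟨i, hi, hi'⟩ := hsq.approxBound hbar hDdeg (P.map res) (Q.map res) hQ0
  -- The reduced error still vanishes up to the degree of the original `q`, whereas Liouville's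
  -- bound only involves the degree of the reduced one; comparing the two bounds the loss of degree.
  have hlt : (q.natDegree : ℤ) < i := by
    by_contra! hle
    refine hi' ?_
    have h1 : ∑ l ∈ Finset.range (q.natDegree + 1), Q.coeff l * sA.coeff (i + l)
        = if i ≤ 0 then P.coeff (-i).toNat else 0 := by
      refine Subtype.ext ?_
      have h2 : ∑ l ∈ Finset.range (q.natDegree + 1), (C (q.coeff i₀)⁻¹ * q).coeff l
          * s.coeff (i + l) = (q.coeff i₀)⁻¹ * (ofPoly p).coeff i := by
        have h3 := hpq i hle
        rw [HahnSeries.coeff_sub, sub_eq_zero, coeff_ofPoly_mul q.natDegree.lt_succ_self] at h3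
        rw [← h3, Finset.mul_sum]
        exact Finset.sum_congr rfl fun l _ => by rw [coeff_C_mul, mul_assoc]
      have h4 : ((∑ l ∈ Finset.range (q.natDegree + 1), Q.coeff l * sA.coeff (i + l) :
          v.valuationSubring) : F) = (q.coeff i₀)⁻¹ * (ofPoly p).coeff i := by
        rw [← h2]
        push_cast
        exact Finset.sum_congr rfl fun l _ => by rw [hQ]; rfl
      rw [h4]
      split_ifs with hi0
      · have hi1 : -(((-i).toNat : ℕ) : ℤ) = i := by omega
        rw [hP, coeff_C_mul, ← coeff_ofPoly_neg p, hi1]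
      · rw [coeff_ofPoly_pos _ (by omega), mul_zero]; rfl
    rw [HahnSeries.coeff_sub, coeff_ofPoly_mul (n := q.natDegree + 1)
      (lt_of_le_of_lt (natDegree_map_le.trans hQdeg) (Nat.lt_succ_self _))]
    simp only [coeff_map, coeff_mapSeries, ← map_mul, ← map_sum]
    rw [h1]
    split_ifs with hi0
    · have hi1 : -(((-i).toNat : ℕ) : ℤ) = i := by omega
      rw [← coeff_map, ← coeff_ofPoly_neg, hi1, sub_self]
    · rw [coeff_ofPoly_pos _ (by omega), map_zero, sub_zero]
  refine ⟨(Q.map res).natDegree, by omega, ?_⟩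
  have hlead : res (Q.coeff (Q.map res).natDegree) ≠ 0 := by
    rw [← coeff_map]
    exact leadingCoeff_ne_zero.mpr hQ0
  have hge : ¬ v ((Q.coeff (Q.map res).natDegree : v.valuationSubring) : F) < 1 :=
    fun hlt => hlead (residue_eq_zero_of_lt v hlt)
  rw [hQ, coeff_C_mul, map_mul, map_inv₀, not_lt] at hge
  have hge' : v (q.coeff i₀) ≤ v (q.coeff (Q.map res).natDegree) := by
    have := mul_le_mul_right hge (v (q.coeff i₀))
    rwa [mul_one, mul_inv_cancel_left₀ hvc] at this
  refine ⟨?_, fun j => (hmax' j).trans hge'⟩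
  rw [← Valuation.ne_zero_iff v]
  exact (lt_of_lt_of_le (zero_lt_iff.mpr hvc) hge').ne'

end Reduction

/-! ### Radicals of the inverse of a uniformizer -/

section Radical

variable {F Ω : Type*} [Field F] [Field Ω] [Algebra F Ω] {v : Valuation F (WithZero (Multiplicative ℤ))}

/-- An `r`-th root of the inverse of a uniformizer has degree at least `r`. -/
theorem le_natDegree_minpoly {ϖ : F} (hϖ : v ϖ = WithZero.exp (-1 : ℤ)) {r : ℕ} (hr : 0 < r)
    {x : Ω} (hx : x ^ r = algebraMap F Ω ϖ⁻¹) : r ≤ (minpoly F x).natDegree := by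
  have hint : IsIntegral F x :=
    ⟨X ^ r - C ϖ⁻¹, monic_X_pow_sub_C _ hr.ne', by simp [hx]⟩
  have hfin : FiniteDimensional F (IntermediateField.adjoin F {x}) :=
    IntermediateField.adjoin.finiteDimensional hint
  have hgen : IntermediateField.AdjoinSimple.gen F x ^ r
      = algebraMap F (IntermediateField.adjoin F {x}) ϖ⁻¹ := by
    refine Subtype.ext ?_
    simpa using hx
  -- Taking norms from `F(x)` gives `y ^ r = ϖ⁻¹ ^ m` with `m` the degree of `x`; valuations then
  -- give `r ∣ m`.
  have hn := congrArg (Algebra.norm F) hgen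
  rw [map_pow, Algebra.norm_algebraMap, IntermediateField.adjoin.finrank hint] at hn
  set m := (minpoly F x).natDegree with hm
  have hm0 : 0 < m := minpoly.natDegree_pos hint
  set y := Algebra.norm F (IntermediateField.AdjoinSimple.gen F x)
  have hϖ0 : ϖ ≠ 0 := by
    rintro rfl
    rw [map_zero] at hϖ
    exact WithZero.exp_ne_zero hϖ.symm
  have hy0 : y ≠ 0 := by
    intro h
    rw [h, zero_pow hr.ne'] at hn
    exact pow_ne_zero m (inv_ne_zero hϖ0) hn.symm
  have hv := congrArg (fun z => WithZero.log (v z)) hn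
  simp only [map_pow, map_inv₀, hϖ, WithZero.log_pow, WithZero.log_inv, WithZero.log_exp] at hv
  have hdvd : (r : ℤ) ∣ m := ⟨WithZero.log (v y), by simpa using hv.symm⟩
  exact Nat.le_of_dvd hm0 (Int.natCast_dvd_natCast.mp hdvd)

/-- A polynomial with a coefficient of maximal valuation among its leading `r` coefficients does not
vanish at the `r`-th roots of the inverse of a uniformizer. -/
theorem aeval_ne_zero_of_dominant_coeff {ϖ : F} (hϖ : v ϖ = WithZero.exp (-1 : ℤ)) {r : ℕ}
    {x : Ω} (hx : x ^ r = algebraMap F Ω ϖ⁻¹) {q : F[X]} {i₀ : ℕ} (hi₀ : q.natDegree < i₀ + r)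
    (hc : q.coeff i₀ ≠ 0) (hmax : ∀ j, v (q.coeff j) ≤ v (q.coeff i₀)) : aeval x q ≠ 0 := by
  intro h0
  have hi₀' : i₀ ≤ q.natDegree := le_natDegree_of_ne_zero hc
  have hr : 0 < r := by omega
  -- Exponents reduced modulo `r` by means of `x ^ r = ϖ⁻¹`; `G` has degree below that of the
  -- minimal polynomial, so `G(x) = 0` forces `G = 0`.
  set G : F[X] := ∑ i ∈ Finset.range (q.natDegree + 1),
    monomial (i % r) (q.coeff i * ϖ⁻¹ ^ (i / r)) with hG
  have hGx : aeval x G = aeval x q := by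
    rw [hG, map_sum, aeval_eq_sum_range (p := q) x]
    refine Finset.sum_congr rfl fun i _ => ?_
    rw [aeval_monomial, map_mul, map_pow, ← hx, ← pow_mul, mul_assoc, ← pow_add, add_comm,
      Nat.mod_add_div, Algebra.smul_def]
  have hGdeg : G.degree < r := by
    rw [degree_lt_iff_coeff_zero]
    intro j hj
    rw [hG, finsetSum_coeff]
    refine Finset.sum_eq_zero fun i _ => ?_
    rw [coeff_monomial, if_neg (by have := Nat.mod_lt i hr; omega)]
  have hG0 : G = 0 := by
    by_contra hne
    have h1 := minpoly.degree_le_of_ne_zero F x hne (by rw [hGx, h0])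
    have h2 := le_natDegree_minpoly hϖ hr hx
    have h3 := natDegree_le_natDegree h1
    have h4 := (natDegree_lt_iff_degree_lt hne).mpr hGdeg
    omega
  have hco : G.coeff (i₀ % r) = 0 := by rw [hG0, coeff_zero]
  rw [hG, finsetSum_coeff, ← Finset.add_sum_erase _ _ (a := i₀) (by simp; omega),
    coeff_monomial, if_pos rfl] at hco
  have hvϖ : v ϖ⁻¹ = WithZero.exp (1 : ℤ) := by rw [map_inv₀, hϖ, ← WithZero.exp_neg, neg_neg]
  have hexp : ∀ n : ℕ, v (ϖ⁻¹ ^ n) = WithZero.exp (n : ℤ) := fun n => by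
    rw [map_pow, hvϖ, ← WithZero.exp_nsmul]; simp
  have hvc : 0 < v (q.coeff i₀) := zero_lt_iff.mpr ((Valuation.ne_zero_iff v).mpr hc)
  have hpos : v (q.coeff i₀ * ϖ⁻¹ ^ (i₀ / r)) ≠ 0 := by
    rw [map_mul, hexp]
    exact mul_ne_zero hvc.ne' WithZero.exp_ne_zero
  -- Any other `i ≡ i₀` modulo `r` satisfies `i < i₀`, since `i ≤ deg q < i₀ + r`. Its term carries
  -- a lower power of `ϖ⁻¹`, hence is strictly smaller.
  have hlt := v.map_sum_lt (s := (Finset.range (q.natDegree + 1)).erase i₀)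
    (f := fun i => (monomial (i % r) (q.coeff i * ϖ⁻¹ ^ (i / r))).coeff (i₀ % r)) hpos
    (fun i hi => by
      rw [Finset.mem_erase, Finset.mem_range] at hi
      rw [coeff_monomial]
      split_ifs with hmod
      · have hdiv : i / r < i₀ / r := by
          have h1 := Nat.div_add_mod i r
          have h2 := Nat.div_add_mod i₀ r
          by_contra! hle
          rcases hle.eq_or_lt with h3 | h3
          · rw [h3] at h2
            omega
          · have h4 : r * (i₀ / r + 1) ≤ r * (i / r) := Nat.mul_le_mul_left r h3
            rw [mul_add, mul_one] at h4
            omega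
        rw [map_mul, map_mul, hexp, hexp]
        have hexp_lt : WithZero.exp ((i / r : ℕ) : ℤ) < WithZero.exp ((i₀ / r : ℕ) : ℤ) := by
          rw [WithZero.exp_lt_exp]
          exact_mod_cast hdiv
        refine lt_of_le_of_lt (b := v (q.coeff i₀) * WithZero.exp ((i / r : ℕ) : ℤ)) ?_ ?_
        · gcongr
          exact hmax i
        · gcongr
      · rw [map_zero]
        exact zero_lt_iff.mpr hpos)
  have := v.map_add_eq_of_lt_left hlt
  rw [hco, map_zero] at this
  exact hpos this.symm

end Radical

/-! ### Finiteness of the set of primes of bad reduction -/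

open IsDedekindDomain in
theorem finite_setOf_valuation_ne_one {R F : Type*} [CommRing R] [IsDedekindDomain R] [Field F]
    [Algebra R F] [IsFractionRing R F] {x : F} (hx : x ≠ 0) :
    {P : HeightOneSpectrum R | P.valuation F x ≠ 1}.Finite := by
  refine ((HeightOneSpectrum.Support.finite R x).union
    (HeightOneSpectrum.Support.finite R x⁻¹)).subset fun P hP => ?_
  rcases lt_or_gt_of_ne hP with h | h
  · right
    change 1 < P.valuation F x⁻¹
    rw [map_inv₀]
    exact (one_lt_inv₀ (zero_lt_iff.mpr ((Valuation.ne_zero_iff _).mpr hx))).mpr h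
  · left
    exact h

open IsDedekindDomain in
-- Good reduction follows once finitely many nonzero elements are units at the prime: `2`, the
-- nonzero coefficients of `D`, and the leading coefficient of `D - ⌊s⌋²`, which is nonzero because
-- `D` is not a square.
theorem finite_badReduction (R : Type*) {F : Type*} [CommRing R] [IsDedekindDomain R] [Field F]
    [Algebra R F] [IsFractionRing R F] (h2 : (2 : F) ≠ 0) {D : F[X]} (hD : ¬ IsSquare D)
    (s : LaurentSeries F) :
    {P : HeightOneSpectrum R | ¬ GoodReduction (P.valuation F) s D}.Finite := by
  have hD0 : D ≠ 0 := by
    rintro rfl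
    exact hD ⟨0, by simp⟩
  have hR : D - polyPart s ^ 2 ≠ 0 := by
    intro h
    exact hD ⟨polyPart s, by linear_combination h⟩
  have hcoef : (⋃ i ∈ D.support, {P : HeightOneSpectrum R | P.valuation F (D.coeff i) ≠ 1}).Finite :=
    Set.Finite.biUnion D.support.finite_toSet fun i hi =>
      finite_setOf_valuation_ne_one (mem_support_iff.mp hi)
  refine (((finite_setOf_valuation_ne_one (R := R) h2).union hcoef).union
    (finite_setOf_valuation_ne_one (R := R) (leadingCoeff_ne_zero.mpr hR))).subset fun P hP => ?_
  by_contra hnot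
  simp only [Set.mem_union, Set.mem_iUnion, not_or, not_exists] at hnot
  obtain ⟨⟨ha, hb⟩, hc⟩ := hnot
  have hb' : ∀ i, D.coeff i ≠ 0 → P.valuation F (D.coeff i) = 1 := fun i hi =>
    not_not.mp (hb i (mem_support_iff.mpr hi))
  refine hP ⟨not_not.mp ha, hb' _ (leadingCoeff_ne_zero.mpr hD0), fun i => ?_,
    ⟨_, not_not.mp hc⟩⟩
  by_cases hi : D.coeff i = 0
  · rw [hi, map_zero]; exact zero_le_one
  · exact (hb' i hi).le

/-! ### Roots of the denominators of the convergents -/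

theorem not_isRoot_convDen {F Ω : Type*} [Field F] [Field Ω] [Algebra F Ω]
    {v : Valuation F (WithZero (Multiplicative ℤ))} {s : LaurentSeries F} {D : F[X]}
    (h : GoodReduction v s D) (hs : IsSqrt s D) (hD : ¬ IsSquare D) {d : ℕ}
    (hd : D.natDegree = 2 * d) (hd0 : 0 < d) {ϖ : F} (hϖ : v ϖ = WithZero.exp (-1 : ℤ)) {r : ℕ}
    (hr : d ≤ r) {x : Ω} (hx : x ^ r = algebraMap F Ω ϖ⁻¹) (n : ℕ) :
    ¬ (convDen (mapSeries (algebraMap F Ω) s) n).IsRoot x := by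
  have hirr : Irrat s := (hs.approxBound hD hd.le).irrat
  have hq := hirr.convDen_ne_zero n
  have herr := hirr.order_error n
  have hdeg := (hirr.natDegree_convDen n).2
  have hpos := hirr.natDegree_partialQuotient_pos n
  obtain ⟨i, hi, hc, hmax⟩ := h.exists_dominant_coeff hs hd hd0 hq (p := convNum s n)
    fun j hj => HahnSeries.coeff_eq_zero_of_lt_order (by omega)
  rw [convDen_mapSeries, IsRoot.def, eval_map_algebraMap]
  exact aeval_ne_zero_of_dominant_coeff hϖ hx (by omega) hc hmax

theorem exists_map_fieldOfSqrt (D : (AlgebraicClosure ℚ)[X]) :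
    ∃ D' : (fieldOfSqrt D)[X], D'.map (algebraMap (fieldOfSqrt D) (AlgebraicClosure ℚ)) = D := by
  have : D ∈ lifts (algebraMap (fieldOfSqrt D) (AlgebraicClosure ℚ)) := by
    rw [lifts_iff_coeff_lifts]
    intro n
    exact ⟨⟨D.coeff n, IntermediateField.subset_adjoin _ _ (Or.inl ⟨n, rfl⟩)⟩, rfl⟩
  rw [mem_lifts] at this
  exact this

theorem exists_forall_not_isRoot {D : (AlgebraicClosure ℚ)[X]} {d : ℕ} (hD : MemS D)
    (hd : D.natDegree = 2 * d) :
    ∃ N : ℕ, ∀ P : IsDedekindDomain.HeightOneSpectrum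
        (NumberField.RingOfIntegers (fieldOfSqrt D)),
      N ≤ Ideal.absNorm P.asIdeal →
      ∀ ϖ : fieldOfSqrt D, P.valuation (fieldOfSqrt D) ϖ = WithZero.exp (-1 : ℤ) →
      ∀ r : ℕ, d ≤ r → ∀ x : AlgebraicClosure ℚ, x ^ r = 1 / (ϖ : AlgebraicClosure ℚ) →
      ∀ s : LaurentSeries (AlgebraicClosure ℚ), IsSqrt s D →
      ∀ n : ℕ, ¬ (convDen s n).IsRoot x := by
  obtain ⟨D', hD'⟩ := exists_map_fieldOfSqrt D
  set ι := algebraMap (fieldOfSqrt D) (AlgebraicClosure ℚ) with hι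
  have hdeg : D'.natDegree = D.natDegree :=
    (natDegree_map ι).symm.trans (congrArg natDegree hD')
  have hd0 : 0 < d := by have := hD.natDegree_pos; omega
  have hsq : ¬ IsSquare D' := by
    rintro ⟨E, hE⟩
    exact hD.not_isSquare ⟨E.map ι, hD'.symm.trans (by rw [hE, Polynomial.map_mul])⟩
  have hmem : MemS D' := by
    refine ⟨hdeg ▸ hD.natDegree_pos, hdeg ▸ hD.even_natDegree, hsq, ?_⟩
    obtain ⟨c, hc⟩ := hD.isSquare_leadingCoeff
    refine ⟨⟨c, IntermediateField.subset_adjoin _ _ (Or.inr ?_)⟩, ι.injective ?_⟩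
    · change c ^ 2 = _
      rw [sq, hc]
    · have hlc : ι D'.leadingCoeff = D.leadingCoeff :=
        (leadingCoeff_map ι).symm.trans (congrArg Polynomial.leadingCoeff hD')
      exact hlc.trans hc
  obtain ⟨s₀, hs₀⟩ := exists_isSqrt hmem
  -- Both signs are treated, so that one bound `N` serves every choice of `√D`.
  have hs₁ : IsSqrt (-s₀) D' := by rw [IsSqrt, neg_sq]; exact hs₀
  have hfin := (finite_badReduction (NumberField.RingOfIntegers (fieldOfSqrt D)) two_ne_zero hsq
    s₀).union (finite_badReduction (NumberField.RingOfIntegers (fieldOfSqrt D)) two_ne_zero hsq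
    (-s₀))
  obtain ⟨N, hN⟩ := (hfin.image fun P => Ideal.absNorm P.asIdeal).bddAbove
  refine ⟨N + 1, fun P hP ϖ hϖ r hr x hx s hs n => ?_⟩
  have hgood : GoodReduction (P.valuation (fieldOfSqrt D)) s₀ D' ∧
      GoodReduction (P.valuation (fieldOfSqrt D)) (-s₀) D' := by
    by_contra hnot
    have := hN ⟨P, (not_and_or.mp hnot), rfl⟩
    simp only at this
    omega
  have hx' : x ^ r = algebraMap (fieldOfSqrt D) (AlgebraicClosure ℚ) ϖ⁻¹ := by
    rw [hx, map_inv₀, one_div]; rfl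
  have hss : s ^ 2 = mapSeries ι s₀ ^ 2 := by
    rw [← map_pow, show s₀ ^ 2 = ofPoly D' from hs₀, mapSeries_ofPoly, hD']
    exact hs
  rcases sq_eq_sq_iff_eq_or_eq_neg.mp hss with h | h
  · rw [h]
    exact not_isRoot_convDen hgood.1 hs₀ hsq (hdeg.trans hd) hd0 hϖ hr hx' n
  · rw [h, ← map_neg]
    exact not_isRoot_convDen hgood.2 hs₁ hsq (hdeg.trans hd) hd0 hϖ hr hx' n

/-- Take a maximal ideal above a rational prime `p ≥ N`. Its norm is divisible by `p`, since
otherwise a Bézout relation between `p` and the norm, both in the ideal, would put `1` in it. -/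
theorem exists_le_absNorm (F : Type*) [Field F] [NumberField F] (N : ℕ) :
    ∃ P : IsDedekindDomain.HeightOneSpectrum (NumberField.RingOfIntegers F),
      N ≤ Ideal.absNorm P.asIdeal := by
  obtain ⟨p, hNp, hp⟩ := Nat.exists_infinite_primes N
  have hspan : Ideal.span {(p : NumberField.RingOfIntegers F)} ≠ ⊤ := by
    intro h
    have h1 := congrArg Ideal.absNorm h
    rw [Ideal.absNorm_span_singleton, Ideal.absNorm_top] at h1
    have h2 := Algebra.norm_algebraMap (R := ℤ) (S := NumberField.RingOfIntegers F) (p : ℤ)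
    rw [map_natCast] at h2
    rw [h2, Int.natAbs_pow, Int.natAbs_natCast] at h1
    have h3 : 0 < Module.finrank ℤ (NumberField.RingOfIntegers F) := by
      rw [NumberField.RingOfIntegers.rank]
      exact Module.finrank_pos
    exact (Nat.one_lt_pow h3.ne' hp.one_lt).ne' h1
  obtain ⟨M, hM, hle⟩ := Ideal.exists_le_maximal _ hspan
  have hpM : (p : NumberField.RingOfIntegers F) ∈ M :=
    hle (Ideal.mem_span_singleton_self _)
  have hp0 : (p : NumberField.RingOfIntegers F) ≠ 0 := by exact_mod_cast hp.ne_zero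
  have hM0 : M ≠ ⊥ := by
    rintro rfl
    exact hp0 (by simpa using hpM)
  refine ⟨⟨M, hM.isPrime, hM0⟩, hNp.trans ?_⟩
  refine Nat.le_of_dvd (Nat.pos_of_ne_zero (Ideal.absNorm_ne_zero_iff_mem_nonZeroDivisors.mpr
    (mem_nonZeroDivisors_of_ne_zero hM0))) ?_
  by_contra hndvd
  have hco : IsCoprime (p : ℤ) (Ideal.absNorm M : ℤ) :=
    Nat.isCoprime_iff_coprime.mpr ((Nat.Prime.coprime_iff_not_dvd hp).mpr hndvd)
  obtain ⟨a, b, hab⟩ := hco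
  refine hM.ne_top ((Ideal.eq_top_iff_one _).mpr ?_)
  have h1 : (a : NumberField.RingOfIntegers F) * p + b * (Ideal.absNorm M : ℕ) = 1 := by
    exact_mod_cast congrArg (Int.cast : ℤ → NumberField.RingOfIntegers F) hab
  rw [← h1]
  exact M.add_mem (M.mul_mem_left _ hpM) (M.mul_mem_left _ (Ideal.absNorm_mem M))

/-- Infinitely many algebraic numbers are not roots of any convergent denominator of `√D`. -/
theorem infinite_setOf_not_isRoot {D : (AlgebraicClosure ℚ)[X]} (hD : MemS D)
    {s : LaurentSeries (AlgebraicClosure ℚ)} (hs : IsSqrt s D) :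
    {x : AlgebraicClosure ℚ | ∀ n, ¬ (convDen s n).IsRoot x}.Infinite := by
  obtain ⟨d, hd'⟩ := hD.even_natDegree
  have hd : D.natDegree = 2 * d := by omega
  obtain ⟨N, hN⟩ := exists_forall_not_isRoot hD hd
  obtain ⟨P, hP⟩ := exists_le_absNorm (fieldOfSqrt D) N
  obtain ⟨ϖ, hϖ⟩ := P.valuation_exists_uniformizer (fieldOfSqrt D)
  have hpow : ∀ k : ℕ, 0 < k → (ϖ : AlgebraicClosure ℚ) ^ k ≠ 1 := by
    intro k hk h
    have h1 : ϖ ^ k = 1 := Subtype.ext h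
    have h2 := congrArg (fun z => WithZero.log (P.valuation (fieldOfSqrt D) z)) h1
    simp only [map_pow, hϖ, WithZero.log_pow, WithZero.log_exp, map_one, WithZero.log_one] at h2
    simp at h2
    omega
  -- One root for each exponent `d + 1 + r`. A coincidence for two exponents would make `x` a root
  -- of unity, hence `ϖ` too, contradicting its valuation.
  choose x hx using fun r : ℕ => IsAlgClosed.exists_pow_nat_eq
    (1 / (ϖ : AlgebraicClosure ℚ)) (n := d + 1 + r) (by omega)
  refine Set.infinite_of_injective_forall_mem (f := x) ?_ fun r n =>
    hN P hP ϖ hϖ (d + 1 + r) (by omega) (x r) (hx r) s hs n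
  refine Function.Injective.of_lt_imp_ne fun r r' hlt heq => ?_
  have h1 := hx r
  have h2 := hx r'
  obtain ⟨k, rfl⟩ := Nat.exists_eq_add_of_lt hlt
  have hϖ0 : (ϖ : AlgebraicClosure ℚ) ≠ 0 := by
    intro h
    have : ϖ = 0 := Subtype.ext h
    rw [this, map_zero] at hϖ
    exact WithZero.exp_ne_zero hϖ.symm
  rw [← heq, show d + 1 + (r + k + 1) = (d + 1 + r) + (k + 1) by ring, pow_add, h1] at h2
  have h3 : x r ^ (k + 1) = 1 := mul_left_cancel₀ (one_div_ne_zero hϖ0) (by rw [h2, mul_one])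
  refine hpow (k + 1) (by omega) ?_
  have h4 := congrArg (· ^ (k + 1)) h1
  simp only [← pow_mul] at h4
  rw [mul_comm, pow_mul, h3, one_pow, one_div, inv_pow] at h4
  exact inv_eq_one.mp h4.symm

/-! ### Multiplication by products of linear polynomials -/

/-- This makes the result on roots of denominators available for `P√D`, which allows the induction
on the number of linear factors. -/
theorem MemS.sq_mul {K : Type*} [Field K] {D P : K[X]} (hD : MemS D) (hP : P ≠ 0) :
    MemS (P ^ 2 * D) := by
  have hD0 : D ≠ 0 := by
    rintro rfl
    exact hD.not_isSquare ⟨0, by simp⟩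
  have hdeg : (P ^ 2 * D).natDegree = 2 * P.natDegree + D.natDegree := by
    rw [natDegree_mul (pow_ne_zero 2 hP) hD0, natDegree_pow]
  refine ⟨?_, ?_, ?_, ?_⟩
  · have := hD.natDegree_pos
    omega
  · rw [hdeg]
    exact (even_two_mul _).add hD.even_natDegree
  · rintro ⟨S, hS⟩
    have hdvd : P ∣ S := by
      rw [← IsIntegrallyClosed.pow_dvd_pow_iff two_ne_zero]
      exact ⟨D, by rw [sq S, hS]⟩
    obtain ⟨c, rfl⟩ := hdvd
    refine hD.not_isSquare ⟨c, mul_left_cancel₀ (pow_ne_zero 2 hP) ?_⟩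
    linear_combination hS
  · rw [leadingCoeff_mul, leadingCoeff_pow]
    exact (IsSquare.sq _).mul hD.isSquare_leadingCoeff

theorem IsSqrt.mul {K : Type*} [Field K] {s : LaurentSeries K} {D : K[X]} (hs : IsSqrt s D)
    (P : K[X]) : IsSqrt (ofPoly P * s) (P ^ 2 * D) := by
  rw [IsSqrt, mul_pow, show s ^ 2 = ofPoly D from hs, map_mul, map_pow]

theorem prod_X_sub_C_ne_zero {K : Type*} [Field K] {n : ℕ} (l : Fin n → K) :
    ∏ i, (X - C (l i)) ≠ 0 :=
  (monic_prod_of_monic _ _ fun i _ => monic_X_sub_C (l i)).ne_zero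

section

variable {D : (AlgebraicClosure ℚ)[X]} {s : LaurentSeries (AlgebraicClosure ℚ)}

/-- If `l` lowers the approximation exponent of `√D`, it can be extended in infinitely many ways so
that the exponent is lowered further. -/
theorem infinite_setOf_cons (hD : MemS D) (hs : IsSqrt s D) {n m m' : ℕ}
    {l : Fin n → AlgebraicClosure ℚ} (h : ApproxBound (ofPoly (∏ i, (X - C (l i))) * s) m)
    (hm : m ≤ m' + 1) (hm' : 1 ≤ m') :
    {x : AlgebraicClosure ℚ |
      ApproxBound (ofPoly (∏ i, (X - C ((Fin.cons x l : Fin (n + 1) → _) i))) * s) m'}.Infinite := by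
  refine (infinite_setOf_not_isRoot (hD.sq_mul (prod_X_sub_C_ne_zero l)) (hs.mul _)).mono ?_
  intro x hx
  have h1 := h.X_sub_C_mul hx hm hm'
  rw [← mul_assoc, ← map_mul] at h1
  change ApproxBound _ m'
  rw [Fin.prod_univ_succ]
  simpa using h1

/-- The exponent starts at `d`, drops by one with each factor, and stays at `1` once there, since
the factor can always be chosen to avoid the roots of all denominators. -/
theorem exists_approxBound (hD : MemS D) (hs : IsSqrt s D) {d : ℕ} (hd : D.natDegree = 2 * d)
    (n : ℕ) : ∃ l : Fin n → AlgebraicClosure ℚ,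
      ApproxBound (ofPoly (∏ i, (X - C (l i))) * s) (max (d - n) 1) := by
  induction n with
  | zero =>
    refine ⟨Fin.elim0, ?_⟩
    simpa using (hs.approxBound hD.not_isSquare hd.le).mono (le_max_left d 1)
  | succ n ih =>
    obtain ⟨l, hl⟩ := ih
    obtain ⟨x, hx⟩ := (infinite_setOf_cons hD hs hl (m' := max (d - (n + 1)) 1) (by omega)
      (by omega)).nonempty
    exact ⟨_, hx⟩

theorem infinite_setOf_approxBound (hD : MemS D) (hs : IsSqrt s D) {d : ℕ}
    (hd : D.natDegree = 2 * d) {n : ℕ} (hn : 0 < n) :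
    {l : Fin n → AlgebraicClosure ℚ |
      ApproxBound (ofPoly (∏ i, (X - C (l i))) * s) (max (d - n) 1)}.Infinite := by
  obtain ⟨n, rfl⟩ := Nat.exists_eq_add_of_lt hn
  rw [zero_add]
  obtain ⟨l, hl⟩ := exists_approxBound hD hs hd n
  have hinf := infinite_setOf_cons hD hs hl (m' := max (d - (n + 1)) 1) (by omega) (by omega)
  refine (hinf.image (f := fun x => (Fin.cons x l : Fin (n + 1) → AlgebraicClosure ℚ))
    fun x _ y _ hxy => ?_).mono ?_
  · simpa using congrFun hxy 0
  · rintro _ ⟨x, hx, rfl⟩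
    exact hx

/-- There are monic polynomials `P` of every large degree for which all partial quotients of `P √D`
are linear. -/
theorem exists_monic_natDegree_eq (hD : MemS D) (hs : IsSqrt s D) (n : ℕ) :
    ∃ P : (AlgebraicClosure ℚ)[X], P.Monic ∧ P.natDegree = D.natDegree + n ∧
      ApproxBound (ofPoly P * s) 1 := by
  obtain ⟨d, hd⟩ := hD.even_natDegree
  obtain ⟨l, hl⟩ := exists_approxBound hD hs (d := d) (by omega) (D.natDegree + n)
  refine ⟨∏ i, (X - C (l i)), monic_prod_of_monic _ _ fun i _ => monic_X_sub_C (l i), ?_, ?_⟩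
  · rw [natDegree_prod_of_monic _ _ fun i _ => monic_X_sub_C (l i)]
    simp
  · rwa [show max (d - (D.natDegree + n)) 1 = 1 by omega] at hl

end

theorem multConjecture : MultConjecture (AlgebraicClosure ℚ) := by
  intro D hD s hs
  choose P hP hdeg hK using exists_monic_natDegree_eq hD hs
  refine Set.infinite_of_injective_forall_mem (f := P) (fun n n' h => ?_)
    fun n => ⟨hP n, (hK n).limsupDeg_eq_one⟩
  have h1 := hdeg n
  rw [h, hdeg n'] at h1
  omega

/-! ### Equivalence of multiples of a square root -/

theorem Irrat.eq_zero_of_add_mul {K : Type*} [Field K] {s : LaurentSeries K} (h : Irrat s)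
    {a b : K[X]} (hab : ofPoly a + ofPoly b * s = 0) : a = 0 ∧ b = 0 := by
  have hb : b = 0 := by
    by_contra hb
    refine h (-a) b hb ?_
    rw [map_neg]
    linear_combination hab
  refine ⟨?_, hb⟩
  rw [hb, map_zero, zero_mul, add_zero, ofPoly_eq_zero] at hab
  exact hab

/-- Separating the rational part from the coefficient of `s` gives `PQcD = b` and `Pe = aQ`.
Substituting into `Q(ae - bc)` and `P(ae - bc)` shows that `P` and `Q` divide each other, the
determinant being a unit. -/
theorem Equivalent.associated {K : Type*} [Field K] {s : LaurentSeries K} {D P Q : K[X]}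
    (hirr : Irrat s) (hs : IsSqrt s D)
    (h : Equivalent (ofPoly P * s) (ofPoly Q * s)) : Associated P Q := by
  obtain ⟨M, h0, h1⟩ := h
  rw [eq_div_iff h0] at h1
  set a := M 0 0
  set b := M 0 1
  set c := M 1 0
  set e := M 1 1
  have hdet : IsUnit (a * e - b * c) := by
    have := (Matrix.isUnits_det_units M)
    rwa [Matrix.det_fin_two] at this
  have hz : ofPoly (P * Q * c * D - b) + ofPoly (P * e - a * Q) * s = 0 := by
    simp only [map_sub, map_mul, ← show s ^ 2 = ofPoly D from hs]
    linear_combination h1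
  obtain ⟨hb, ha⟩ := hirr.eq_zero_of_add_mul hz
  refine associated_of_dvd_dvd ?_ ?_
  · refine (IsUnit.dvd_mul_right hdet).mp ⟨e ^ 2 - Q ^ 2 * D * c ^ 2, ?_⟩
    linear_combination -e * ha + Q * c * hb
  · refine (IsUnit.dvd_mul_right hdet).mp ⟨a ^ 2 - P ^ 2 * D * c ^ 2, ?_⟩
    linear_combination a * ha + P * c * hb

theorem strongMcMullenConjecture : StrongMcMullenConjecture (AlgebraicClosure ℚ) := by
  intro D hD s hs
  have hirr : Irrat s :=
    (hs.approxBound hD.not_isSquare (d := D.natDegree) (by omega)).irrat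
  -- One monic multiplier in each degree `deg D + n`: associated monic polynomials are equal, so
  -- distinct series in this family are inequivalent.
  choose P hP hdeg hK using exists_monic_natDegree_eq hD hs
  have hinj : Function.Injective fun n => ofPoly (P n) * s := by
    intro n n' h
    have hs0 : s ≠ 0 := by simpa using hirr 0 1 one_ne_zero
    have h1 := hdeg n
    rw [ofPoly_injective (mul_right_cancel₀ hs0 h), hdeg n'] at h1
    omega
  refine ⟨Set.range fun n => ofPoly (P n) * s, Set.infinite_range_of_injective hinj, ?_, ?_⟩
  · rintro _ ⟨n, rfl⟩
    refine ⟨⟨0, P n, 1, (hP n).ne_zero, one_ne_zero, by simp⟩, ?_⟩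
    rw [(hK n).supDeg_eq_one, Nat.cast_one]
  · rintro _ ⟨n, rfl⟩ _ ⟨n', rfl⟩ hne heq
    have h1 := heq.associated hirr hs
    exact hne (by simp only [eq_of_monic_of_associated (hP n) (hP n') h1])

end PolyCF

theorem mainTheorem2 :
    (∀ (D : Polynomial (AlgebraicClosure ℚ)) (d : ℕ), PolyCF.MemS D → D.natDegree = 2 * d →
      ∃ N : ℕ, ∀ P : IsDedekindDomain.HeightOneSpectrum
          (NumberField.RingOfIntegers (PolyCF.fieldOfSqrt D)),
        N ≤ Ideal.absNorm P.asIdeal →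
        ∀ ϖ : PolyCF.fieldOfSqrt D,
          P.valuation (PolyCF.fieldOfSqrt D) ϖ = WithZero.exp (-1 : ℤ) →
        ∀ r : ℕ, d ≤ r → ∀ ζ ρ : AlgebraicClosure ℚ,
          ζ ^ r = 1 → ρ ^ r = 1 / (ϖ : AlgebraicClosure ℚ) →
        ∀ s : LaurentSeries (AlgebraicClosure ℚ), PolyCF.IsSqrt s D →
        ∀ n : ℕ, ¬ (PolyCF.convDen s n).IsRoot (ζ * ρ)) ∧
    (∀ (D : Polynomial (AlgebraicClosure ℚ)) (d : ℕ), PolyCF.MemS D → D.natDegree = 2 * d →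
      ∀ s : LaurentSeries (AlgebraicClosure ℚ), PolyCF.IsSqrt s D →
        (∃ l : Fin (d - 1) → AlgebraicClosure ℚ,
          PolyCF.supDeg
            (PolyCF.ofPoly (∏ i, (Polynomial.X - Polynomial.C (l i))) * s) = 1) ∧
        (2 ≤ d →
          {l : Fin (d - 1) → AlgebraicClosure ℚ |
            PolyCF.supDeg
              (PolyCF.ofPoly (∏ i, (Polynomial.X - Polynomial.C (l i))) * s) = 1}.Infinite)) ∧
    PolyCF.MultConjecture (AlgebraicClosure ℚ) ∧
    PolyCF.StrongMcMullenConjecture (AlgebraicClosure ℚ) := by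
  refine ⟨fun D d hD hd => ?_, fun D d hD hd s hs => ⟨?_, fun h2 => ?_⟩, PolyCF.multConjecture,
    PolyCF.strongMcMullenConjecture⟩
  · obtain ⟨N, hN⟩ := PolyCF.exists_forall_not_isRoot hD hd
    refine ⟨N, fun P hP ϖ hϖ r hr ζ ρ hζ hρ s hs n => hN P hP ϖ hϖ r hr _ ?_ s hs n⟩
    rw [mul_pow, hζ, hρ, one_mul]
  · obtain ⟨l, hl⟩ := PolyCF.exists_approxBound hD hs hd (d - 1)
    rw [show max (d - (d - 1)) 1 = 1 by omega] at hl
    exact ⟨l, hl.supDeg_eq_one⟩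
  · refine (PolyCF.infinite_setOf_approxBound hD hs hd (n := d - 1) (by omega)).mono fun l hl => ?_
    rw [show max (d - (d - 1)) 1 = 1 by omega] at hl
    exact hl.supDeg_eq_one
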